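/- An absolute-valued real algebra is a real normed space $A\neq 0$ with a bilinear product (not assumed associative, commutative or unital) such that $\|xy\|=\|x\|\,\|y\|$ for all $x,y\in A$. Write $(x,y,z)=(xy)z-x(yz)$ for the associator, and let two algebras be isomorphic if there is a linear bijection between them that preserves the products. Let $\mathbb H$ be the real quaternion algebra with its standard conjugation $x\mapsto\overline x$ and its Euclidean norm, let $i$ be the first imaginary unit, and put $e^{i\alpha}=\cos\alpha+(\sin\alpha)\,i$. On the normed space $\mathbb H$ consider the following products, where $a,b\in\mathbb H$ have norm one: $\overset{*}{\mathbb H}$ has $x\odot y=\overline x\,\overline y$; ${}^*\mathbb H(a,b)$ has $x\odot y=\overline x\,a\,y\,b$; $\mathbb H^*(a,b)$ has $x\odot y=a\,x\,b\,\overline y$. Theorem. Let $A$ be an absolute-valued real algebra of dimension $4$. Then $A$ satisfies the identity $(x^2,x,x^2)=0$ for all $x\in A$ if and only if $A$ is isomorphic to $\mathbb H$, to $\overset{*}{\mathbb H}$, to ${}^*\mathbb H(1,e^{i\alpha})$ for some $\alpha\in[0,\pi)$, or to $\mathbb H^*(e^{i\alpha},1)$ for some $\alpha\in[0,\pi)$.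 Moreover, there are infinitely many isomorphism classes of $4$-dimensional absolute-valued real algebras that satisfy $(x^2,x,x^2)=0$. -/

import Mathlib

open scoped Quaternion

universe u v w

/-- An absolute-valued real algebra: a real normed space with a bilinear product
(not assumed associative, commutative or unital) such that `‖xy‖ = ‖x‖ ‖y‖`. -/
structure AbsValuedAlg : Type (u + 1) where
  carrier : Type u
  [group : NormedAddCommGroup carrier]
  [space : NormedSpace ℝ carrier]
  mul : carrier →ₗ[ℝ] carrier →ₗ[ℝ] carrier
  norm_mul : ∀ x y : carrier, ‖mul x y‖ = ‖x‖ * ‖y‖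

namespace AbsValuedAlg

attribute [instance] AbsValuedAlg.group AbsValuedAlg.space

/-- The associator `(x, y, z) = (xy)z - x(yz)`. -/
def assoc (A : AbsValuedAlg.{u}) (x y z : A.carrier) : A.carrier :=
  A.mul (A.mul x y) z - A.mul x (A.mul y z)

/-- The identity `(x², x, x²) = 0`. -/
def Satisfies212 (A : AbsValuedAlg.{u}) : Prop :=
  ∀ x : A.carrier, A.assoc (A.mul x x) x (A.mul x x) = 0

/-- The algebra `A` has dimension four over `ℝ`. -/
def FourDimensional (A : AbsValuedAlg.{u}) : Prop :=
  Module.finrank ℝ A.carrier = 4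

/-- Isomorphism of algebras: a linear bijection that preserves the product. -/
def Iso (A : AbsValuedAlg.{u}) (B : AbsValuedAlg.{v}) : Prop :=
  ∃ f : A.carrier ≃ₗ[ℝ] B.carrier, ∀ x y, f (A.mul x y) = B.mul (f x) (f y)

theorem Iso.refl (A : AbsValuedAlg.{u}) : Iso A A :=
  ⟨LinearEquiv.refl ℝ A.carrier, fun _ _ => rfl⟩

theorem Iso.symm {A : AbsValuedAlg.{u}} {B : AbsValuedAlg.{v}} (h : Iso A B) : Iso B A := by
  obtain ⟨f, hf⟩ := h
  exact ⟨f.symm, fun x y => f.injective (by simp [hf])⟩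

theorem Iso.trans {A : AbsValuedAlg.{u}} {B : AbsValuedAlg.{v}} {C : AbsValuedAlg.{w}}
    (h : Iso A B) (k : Iso B C) : Iso A C := by
  obtain ⟨f, hf⟩ := h
  obtain ⟨g, hg⟩ := k
  exact ⟨f.trans g, fun x y => by simp [hf, hg]⟩

/-- Isomorphism as an equivalence relation; its classes are the isomorphism classes of
absolute-valued real algebras. -/
def isoSetoid : Setoid AbsValuedAlg.{u} where
  r := Iso
  iseqv := ⟨Iso.refl, Iso.symm, Iso.trans⟩

/-- The quaternion algebra `ℍ`, with product `xy`. -/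
noncomputable def quat : AbsValuedAlg.{0} where
  carrier := ℍ[ℝ]
  mul := LinearMap.mul ℝ ℍ[ℝ]
  norm_mul x y := by simp

/-- The doubly-starred `ℍ`, with product `x ⊙ y = x̄ ȳ`. -/
noncomputable def starQuatStar : AbsValuedAlg.{0} where
  carrier := ℍ[ℝ]
  mul := LinearMap.mk₂ ℝ (fun x y : ℍ[ℝ] => star x * star y)
    (fun x x' y => by simp [add_mul]) (fun c x y => by simp)
    (fun x y y' => by simp [mul_add]) (fun c x y => by simp)
  norm_mul x y := by simp

/-- `*ℍ(a, b)`, with product `x ⊙ y = x̄ a y b`, for norm-one quaternions `a`, `b`. -/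
noncomputable def starQuat (a b : Metric.sphere (0 : ℍ[ℝ]) 1) : AbsValuedAlg.{0} where
  carrier := ℍ[ℝ]
  mul := LinearMap.mk₂ ℝ (fun x y : ℍ[ℝ] => star x * a * y * b)
    (fun x x' y => by simp [add_mul]) (fun c x y => by simp)
    (fun x y y' => by simp [mul_add, add_mul]) (fun c x y => by simp)
  norm_mul x y := by simp

/-- `ℍ*(a, b)`, with product `x ⊙ y = a x b ȳ`, for norm-one quaternions `a`, `b`. -/
noncomputable def quatStar (a b : Metric.sphere (0 : ℍ[ℝ]) 1) : AbsValuedAlg.{0} where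
  carrier := ℍ[ℝ]
  mul := LinearMap.mk₂ ℝ (fun x y : ℍ[ℝ] => a * x * b * star y)
    (fun x x' y => by simp [mul_add, add_mul]) (fun c x y => by simp)
    (fun x y y' => by simp [mul_add]) (fun c x y => by simp)
  norm_mul x y := by simp

/-- The norm-one quaternion `e^{iα} = cos α + (sin α) i`. -/
noncomputable def expI (α : ℝ) : Metric.sphere (0 : ℍ[ℝ]) 1 :=
  ⟨((Complex.exp (α * Complex.I) : ℂ) : ℍ[ℝ]), by
    rw [mem_sphere_zero_iff_norm, ← sq_eq_sq₀ (norm_nonneg _) zero_le_one, sq,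
      ← Quaternion.normSq_eq_norm_mul_self, Quaternion.normSq_def']
    simp [Complex.exp_ofReal_mul_I_re, Complex.exp_ofReal_mul_I_im]⟩

end AbsValuedAlg

/-! ### Invariant inner products from transitive isometry groups -/

section InvariantForm

open MeasureTheory Metric

variable {V : Type*} [NormedAddCommGroup V] [NormedSpace ℝ V] [FiniteDimensional ℝ V]

/-! The norm is first shown to be Euclidean. Multiplications by norm-one elements are isometries
acting transitively on spheres, and averaging over the unit ball gives an isometry-invariant
positive form, which must be a multiple of the squared norm (`parallelogram_of_transitive`).
Twisting the product by the inverses of the two multiplications by a unit vector `c` gives a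
composition algebra with unit `c²`, hence `ℍ` (`exists_quaternion_equiv`). So the product is `φ(x)
ψ(y)` on `ℍ` with `φ`, `ψ` linear isometries.

Every isometry of `ℍ` is `x ↦ p x q` or `x ↦ p x̄ q`. A one-sided multiplication absorbs the inner
constants, leaving four families with unit parameters `a`, `b` (`exists_normal_form`). In each
family, `(x², x, x²) = 0` is tested on `1 ± v` or on imaginary elements, with `v` imaginary and
orthogonal to `a`, `b`, so that moving `v` past them conjugates them. This forces both parameters to
be `±1` when neither or both factors are conjugated, and the one between the factors to be `±1`
otherwise. The remaining parameter is conjugate to `±e^{iα}`, and `x ↦ -x` absorbs the sign.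

Conversely, in `*ℍ(1, b)` the square of `x` is `‖x‖² b`. So `b` is the only nonzero idempotent, and
left multiplication by it, `y ↦ b̄ y b`, is an isomorphism invariant. Its rotation angle determines
`(Re b)²` when the target parameter has square different from `1`, which yields infinitely many
classes. -/

theorem LinearIsometryEquiv.measurePreserving_addHaar [MeasurableSpace V] [BorelSpace V]
    (μ : Measure V) [μ.IsAddHaarMeasure] (g : V ≃ₗᵢ[ℝ] V) : MeasurePreserving g μ μ := by
  refine ⟨g.continuous.measurable, ?_⟩
  have hdet : LinearMap.det (g.toLinearEquiv : V →ₗ[ℝ] V) ≠ 0 :=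
    (LinearEquiv.isUnit_det' g.toLinearEquiv).ne_zero
  have hmap := Measure.map_linearMap_addHaar_eq_smul_addHaar μ hdet
  -- The unit ball is its own preimage and has positive finite measure, so the scaling factor is 1.
  have hball := congrArg (fun ν : Measure V => ν (closedBall 0 1)) hmap
  have hpre : (⇑(g.toLinearEquiv : V →ₗ[ℝ] V)) ⁻¹' closedBall 0 1 = closedBall 0 1 := by
    ext x; simp
  have hmeas : Measurable (⇑(g.toLinearEquiv : V →ₗ[ℝ] V)) := g.continuous.measurable
  simp only [Measure.map_apply hmeas measurableSet_closedBall, hpre, Measure.smul_apply,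
    smul_eq_mul] at hball
  have hpos : μ (closedBall (0 : V) 1) ≠ 0 := (measure_closedBall_pos μ _ one_pos).ne'
  have hfin : μ (closedBall (0 : V) 1) ≠ ⊤ := measure_closedBall_lt_top.ne
  have hone : ENNReal.ofReal |(LinearMap.det (g.toLinearEquiv : V →ₗ[ℝ] V))⁻¹| = 1 := by
    refine (ENNReal.mul_left_inj hpos hfin).1 ?_
    rw [one_mul, ← hball]
  rw [hone, one_smul] at hmap
  exact hmap

variable (V) in
/-- The second-moment operator of the unit ball, `f ↦ ∫ x in ball, f x • x`. -/
noncomputable def ballMoment [MeasurableSpace V] [BorelSpace V] (μ : Measure V)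
    [μ.IsAddHaarMeasure] : Module.Dual ℝ V →ₗ[ℝ] V where
  toFun f := ∫ x in closedBall (0 : V) 1, f x • x ∂μ
  map_add' f g := by
    have hint (f : Module.Dual ℝ V) :
        IntegrableOn (fun x : V => f x • x) (closedBall (0 : V) 1) μ :=
      (f.continuous_of_finiteDimensional.smul continuous_id).continuousOn.integrableOn_compact
        (isCompact_closedBall _ _)
    simp only [LinearMap.add_apply, add_smul]
    exact integral_add (hint f) (hint g)
  map_smul' c f := by
    simp only [LinearMap.smul_apply, smul_assoc, RingHom.id_apply]
    exact integral_smul c _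

theorem apply_ballMoment_pos [MeasurableSpace V] [BorelSpace V] (μ : Measure V)
    [μ.IsAddHaarMeasure] {f : Module.Dual ℝ V} (hf : f ≠ 0) : 0 < f (ballMoment V μ f) := by
  have hc := f.continuous_of_finiteDimensional
  have hint : IntegrableOn (fun x : V => f x • x) (closedBall (0 : V) 1) μ :=
    (hc.smul continuous_id).continuousOn.integrableOn_compact (isCompact_closedBall _ _)
  have hval : f (ballMoment V μ f) = ∫ x in closedBall (0 : V) 1, f x * f x ∂μ := by
    have := (LinearMap.toContinuousLinearMap f).integral_comp_comm hint
    simp only [LinearMap.coe_toContinuousLinearMap', map_smul, smul_eq_mul] at this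
    exact this.symm
  rw [hval, setIntegral_pos_iff_support_of_nonneg_ae
    (Filter.Eventually.of_forall fun x => mul_self_nonneg _)
    ((hc.mul hc).continuousOn.integrableOn_compact (isCompact_closedBall _ _))]
  have hopen : IsOpen (Function.support (fun x => f x * f x) ∩ ball (0 : V) 1) :=
    ((hc.mul hc).isOpen_support).inter isOpen_ball
  refine (hopen.measure_pos μ ?_).trans_le
    (measure_mono (Set.inter_subset_inter_right _ ball_subset_closedBall))
  obtain ⟨x, hx⟩ : ∃ x, f x ≠ 0 := by
    by_contra! h
    exact hf (LinearMap.ext h)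
  have hx0 : 0 < ‖x‖ := norm_pos_iff.2 fun h => hx (by simp [h])
  -- Rescaled to norm 1/2, hence inside the open ball.
  refine ⟨(2 * ‖x‖)⁻¹ • x, ?_, ?_⟩
  · simp [hx, hx0.ne']
  · rw [mem_ball_zero_iff, norm_smul, norm_inv, norm_mul, norm_norm]
    norm_num
    field_simp
    norm_num

theorem ballMoment_comp [MeasurableSpace V] [BorelSpace V] (μ : Measure V)
    [μ.IsAddHaarMeasure] (g : V ≃ₗᵢ[ℝ] V) (f : Module.Dual ℝ V) :
    g (ballMoment V μ (f ∘ₗ (g.toLinearEquiv : V →ₗ[ℝ] V))) = ballMoment V μ f := by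
  have hc := f.continuous_of_finiteDimensional
  have hint : IntegrableOn (fun x : V => f (g x) • x) (closedBall (0 : V) 1) μ :=
    ((hc.comp g.continuous).smul continuous_id).continuousOn.integrableOn_compact
      (isCompact_closedBall _ _)
  have h1 := (g.measurePreserving_addHaar μ).setIntegral_preimage_emb
    g.toHomeomorph.measurableEmbedding (fun x => f x • x) (closedBall 0 1)
  have hpre : g ⁻¹' closedBall 0 1 = closedBall 0 1 := by ext x; simp
  rw [hpre] at h1
  have h2 := (g.toContinuousLinearEquiv : V →L[ℝ] V).integral_comp_comm hint
  simp only [ContinuousLinearEquiv.coe_coe, LinearIsometryEquiv.coe_toContinuousLinearEquiv,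
    map_smul] at h2
  exact h2.symm.trans h1

/-- If the linear isometries act transitively on the spheres of a finite-dimensional normed space,
then the norm satisfies the parallelogram law. -/
theorem parallelogram_of_transitive
    (h : ∀ x y : V, ‖x‖ = ‖y‖ → ∃ g : V ≃ₗᵢ[ℝ] V, g x = y) (x y : V) :
    ‖x + y‖ * ‖x + y‖ + ‖x - y‖ * ‖x - y‖ = 2 * (‖x‖ * ‖x‖ + ‖y‖ * ‖y‖) := by
  let _ : MeasurableSpace V := borel V
  have _ : BorelSpace V := ⟨rfl⟩
  let μ : Measure V := Measure.addHaar
  have hinj : Function.Injective (ballMoment V μ) := by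
    rw [← LinearMap.ker_eq_bot, LinearMap.ker_eq_bot']
    intro f hf
    by_contra hne
    have := apply_ballMoment_pos μ hne
    rw [hf, map_zero] at this
    exact lt_irrefl _ this
  let S : Module.Dual ℝ V ≃ₗ[ℝ] V :=
    LinearEquiv.ofInjectiveOfFinrankEq (ballMoment V μ) hinj Subspace.dual_finrank_eq
  have hS (f) : S f = ballMoment V μ f := rfl
  -- Equivariance of `S` makes this quadratic form isometry-invariant; transitivity then makes it
  -- `c‖x‖²`.
  have hinv (g : V ≃ₗᵢ[ℝ] V) (x : V) : S.symm (g x) (g x) = S.symm x x := by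
    have : S.symm (g x) ∘ₗ (g.toLinearEquiv : V →ₗ[ℝ] V) = S.symm x := by
      apply S.injective
      apply g.injective
      rw [hS, ballMoment_comp, ← hS]
      simp
    rw [← this]
    rfl
  rcases subsingleton_or_nontrivial V with hV | hV
  · simp [Subsingleton.elim _ (0 : V)]
  obtain ⟨v₀, hv₀⟩ := exists_norm_eq V zero_le_one
  set c := S.symm v₀ v₀ with hc
  have hc0 : 0 < c := by
    have hne : S.symm v₀ ≠ 0 := by
      intro h0
      have : v₀ = 0 := by simpa using h0
      simp [this] at hv₀
    have := apply_ballMoment_pos μ hne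
    rwa [← hS, S.apply_symm_apply] at this
  have hB (x : V) : S.symm x x = c * (‖x‖ * ‖x‖) := by
    obtain ⟨g, hg⟩ := h (‖x‖ • v₀) x (by simp [norm_smul, hv₀])
    rw [← hg, hinv]
    simp only [map_smul, LinearMap.smul_apply, smul_eq_mul, LinearIsometryEquiv.norm_map,
      norm_smul, norm_norm, hv₀, ← hc]
    ring
  have hsum : S.symm (x + y) (x + y) + S.symm (x - y) (x - y)
      = 2 * (S.symm x x + S.symm y y) := by
    simp only [map_add, map_sub, LinearMap.add_apply, LinearMap.sub_apply]
    ring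
  simp only [hB] at hsum
  apply mul_left_cancel₀ hc0.ne'
  linarith

end InvariantForm

/-! ### Unital composition algebras of dimension four -/

section CompositionAlgebra

open scoped RealInnerProductSpace

variable {V : Type*} [NormedAddCommGroup V] [InnerProductSpace ℝ V] {m : V →ₗ[ℝ] V →ₗ[ℝ] V}

theorem inner_mul_left_of_norm_mul (hm : ∀ x y, ‖m x y‖ = ‖x‖ * ‖y‖) (x y z : V) :
    ⟪m x y, m x z⟫ = ‖x‖ ^ 2 * ⟪y, z⟫ := by
  have h := norm_add_sq_real (m x y) (m x z)
  have h' := norm_add_sq_real y z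
  rw [← map_add, hm, hm, hm] at h
  linear_combination (‖x‖ ^ 2 * h' - h) / 2

theorem inner_mul_add_inner_mul (hm : ∀ x y, ‖m x y‖ = ‖x‖ * ‖y‖) (x y z w : V) :
    ⟪m x y, m z w⟫ + ⟪m z y, m x w⟫ = 2 * ⟪x, z⟫ * ⟪y, w⟫ := by
  have h := inner_mul_left_of_norm_mul hm (x + z) y w
  rw [norm_add_sq_real] at h
  simp only [map_add, LinearMap.add_apply, inner_add_left, inner_add_right,
    inner_mul_left_of_norm_mul hm] at h
  linear_combination h

/-- Polarisation against the left unit: left multiplication by `x ⟂ e` is skew. As it also scales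
norms by `‖x‖`, its square is `-‖x‖²`. -/
theorem inner_mul_eq_neg (hm : ∀ x y, ‖m x y‖ = ‖x‖ * ‖y‖) {e : V} (he : ∀ y, m e y = y)
    {x : V} (hx : ⟪x, e⟫ = 0) (y w : V) : ⟪m x y, w⟫ = -⟪y, m x w⟫ := by
  have h := inner_mul_add_inner_mul hm x y e w
  rw [he, he, hx] at h
  linear_combination h

theorem mul_mul_self_of_norm_mul (hm : ∀ x y, ‖m x y‖ = ‖x‖ * ‖y‖) {e : V} (he : ∀ y, m e y = y)
    {x : V} (hx : ⟪x, e⟫ = 0) (y : V) : m x (m x y) = -(‖x‖ ^ 2) • y := by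
  refine ext_inner_right ℝ fun w => ?_
  rw [inner_mul_eq_neg hm he hx, inner_mul_left_of_norm_mul hm, inner_smul_left]
  simp

theorem mul_mul_anticomm (hm : ∀ x y, ‖m x y‖ = ‖x‖ * ‖y‖) {e : V} (he : ∀ y, m e y = y)
    {x z : V} (hx : ⟪x, e⟫ = 0) (hz : ⟪z, e⟫ = 0) (hxz : ⟪x, z⟫ = 0) (y : V) :
    m x (m z y) = -m z (m x y) := by
  have h := mul_mul_self_of_norm_mul hm he (x := x + z) (by rw [inner_add_left, hx, hz, add_zero]) y
  rw [norm_add_sq_real, hxz] at h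
  simp only [map_add, LinearMap.add_apply, mul_mul_self_of_norm_mul hm he hx,
    mul_mul_self_of_norm_mul hm he hz] at h
  rw [eq_neg_iff_add_eq_zero]
  have h2 : (-(‖x‖ ^ 2 + 2 * 0 + ‖z‖ ^ 2)) • y = (-(‖x‖ ^ 2)) • y + (-(‖z‖ ^ 2)) • y := by module
  rw [h2] at h
  linear_combination (norm := module) h

/-- There is a unit vector orthogonal to a family of fewer vectors than the dimension. -/
theorem exists_unit_orthogonal {W : Type*} [NormedAddCommGroup W] [InnerProductSpace ℝ W] {n : ℕ}
    (u : Fin n → W) (hn : n < Module.finrank ℝ W) : ∃ w : W, ‖w‖ = 1 ∧ ∀ i, ⟪u i, w⟫ = 0 := by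
  have : FiniteDimensional ℝ W := Module.finite_of_finrank_pos (by omega)
  have hlt : (Submodule.span ℝ (Set.range u)) ≠ ⊤ := by
    intro h
    have := finrank_range_le_card (R := ℝ) u
    rw [Set.finrank, h, finrank_top, Fintype.card_fin] at this
    omega
  obtain ⟨w, hw, hw0⟩ := Submodule.exists_mem_ne_zero_of_ne_bot
    (mt (Submodule.orthogonal_eq_bot_iff).1 hlt)
  refine ⟨‖w‖⁻¹ • w, norm_smul_inv_norm hw0, fun i => ?_⟩
  rw [inner_smul_right, Submodule.mem_orthogonal _ _ |>.1 hw _ (Submodule.subset_span ⟨i, rfl⟩),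
    mul_zero]

/-- A four-dimensional real composition algebra with unit is the quaternion algebra. -/
theorem exists_quaternion_equiv (hV : Module.finrank ℝ V = 4)
    (hm : ∀ x y, ‖m x y‖ = ‖x‖ * ‖y‖) {e : V} (hne : ‖e‖ = 1) (hl : ∀ y, m e y = y)
    (hr : ∀ y, m y e = y) :
    ∃ F : ℍ[ℝ] ≃ₗ[ℝ] V, (∀ x, ‖F x‖ = ‖x‖) ∧ ∀ x y, F (x * y) = m (F x) (F y) := by
  obtain ⟨i, hi1, hi⟩ := exists_unit_orthogonal ![e] (by omega)
  obtain ⟨j, hj1, hj⟩ := exists_unit_orthogonal ![e, i] (by omega)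
  have hie : ⟪i, e⟫ = 0 := by rw [real_inner_comm]; exact hi 0
  have hje : ⟪j, e⟫ = 0 := by rw [real_inner_comm]; exact hj 0
  have hij : ⟪i, j⟫ = 0 := hj 1
  have hji : ⟪j, i⟫ = 0 := by rw [real_inner_comm]; exact hij
  set k := m i j with hk
  -- The opposite product satisfies the same law, so each left-multiplication lemma also serves on
  -- the right.
  have hm' : ∀ x y, ‖m.flip x y‖ = ‖x‖ * ‖y‖ := fun x y => by
    rw [LinearMap.flip_apply, hm, mul_comm]
  have hk1 : ‖k‖ = 1 := by rw [hk, hm, hi1, hj1, mul_one]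
  have hke : ⟪k, e⟫ = 0 := by rw [hk, inner_mul_eq_neg hm hl hie, hr, hji, neg_zero]
  have hki : ⟪k, i⟫ = 0 := by
    have := inner_mul_left_of_norm_mul hm i j e
    rw [hr, hje, mul_zero] at this; exact this
  have hkj : ⟪k, j⟫ = 0 := by
    have := inner_mul_left_of_norm_mul hm' j i e
    rw [LinearMap.flip_apply, LinearMap.flip_apply, hl, hie, mul_zero] at this; exact this
  have hsq {x : V} (hx : ⟪x, e⟫ = 0) (hx1 : ‖x‖ = 1) : m x x = -e := by
    have := mul_mul_self_of_norm_mul hm hl hx e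
    rw [hr, hx1] at this; simpa using this
  have hii := hsq hie hi1
  have hjj := hsq hje hj1
  have hkk := hsq hke hk1
  have hji' : m j i = -k := by
    have := mul_mul_anticomm hm hl hje hie hji e
    rwa [hr, hr] at this
  have hik : m i k = -j := by
    have := mul_mul_self_of_norm_mul hm hl hie j
    rw [hi1] at this; simpa using this
  have hjk : m j k = i := by
    have := mul_mul_anticomm hm hl hje hie hji j
    rwa [hjj, map_neg, hr, neg_neg] at this
  have hki' : m k i = j := by
    have := mul_mul_anticomm hm' hr hie hje hij i
    simp only [LinearMap.flip_apply] at this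
    rw [hii, map_neg, LinearMap.neg_apply, hl, neg_neg] at this
    exact this
  have hkj' : m k j = -i := by
    have := mul_mul_self_of_norm_mul hm' hr hje i
    simp only [LinearMap.flip_apply] at this
    rw [hj1] at this; simpa using this
  let F : ℍ[ℝ] →ₗ[ℝ] V :=
    { toFun := fun q => q.re • e + q.imI • i + q.imJ • j + q.imK • k
      map_add' := fun p q => by simp; module
      map_smul' := fun c q => by simp; module }
  have hF (q) : F q = q.re • e + q.imI • i + q.imJ • j + q.imK • k := rfl
  have hnorm (q) : ‖F q‖ = ‖q‖ := by
    rw [← sq_eq_sq₀ (norm_nonneg _) (norm_nonneg _), sq ‖q‖, ← Quaternion.normSq_eq_norm_mul_self,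
      Quaternion.normSq_def', ← real_inner_self_eq_norm_sq, hF]
    have hei : ⟪e, i⟫ = 0 := hi 0
    have hej : ⟪e, j⟫ = 0 := hj 0
    have hek : ⟪e, k⟫ = 0 := by rw [real_inner_comm]; exact hke
    have hik : ⟪i, k⟫ = 0 := by rw [real_inner_comm]; exact hki
    have hjk : ⟪j, k⟫ = 0 := by rw [real_inner_comm]; exact hkj
    simp only [inner_add_left, inner_add_right, real_inner_smul_left, real_inner_smul_right,
      real_inner_self_eq_norm_sq, hne, hi1, hj1, hk1, hie, hje, hij, hji, hke, hki, hkj, hei, hej,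
      hek, hik, hjk, norm_smul, mul_pow, Real.norm_eq_abs, sq_abs]
    ring
  have hinj : Function.Injective F := by
    rw [← LinearMap.ker_eq_bot, LinearMap.ker_eq_bot']
    intro q hq
    rw [← norm_eq_zero, ← hnorm, hq, norm_zero]
  have : FiniteDimensional ℝ V := Module.finite_of_finrank_pos (by omega)
  refine ⟨LinearEquiv.ofInjectiveOfFinrankEq F hinj (by rw [hV, Quaternion.finrank_eq_four]),
    hnorm, fun x y => ?_⟩
  change F (x * y) = m (F x) (F y)
  simp only [hF, map_add, map_smul, LinearMap.add_apply, LinearMap.smul_apply, hl, hr, hii, hjj,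
    hkk, hji', ← hk, hik, hjk, hki', hkj', Quaternion.re_mul, Quaternion.imI_mul,
    Quaternion.imJ_mul, Quaternion.imK_mul]
  module

end CompositionAlgebra

/-! ### Linear isometries of the quaternions -/

namespace Quaternion

open scoped RealInnerProductSpace

theorem star_mul_self_eq_one {a : ℍ[ℝ]} (ha : ‖a‖ = 1) : star a * a = 1 := by
  rw [star_mul_self, normSq_eq_norm_mul_self, ha]; simp

theorem self_mul_star_eq_one {a : ℍ[ℝ]} (ha : ‖a‖ = 1) : a * star a = 1 := by
  rw [self_mul_star, normSq_eq_norm_mul_self, ha]; simp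

theorem eq_one_or_neg_one_of_star_eq {a : ℍ[ℝ]} (ha : ‖a‖ = 1) (h : star a = a) :
    a = 1 ∨ a = -1 := by
  have := star_mul_self_eq_one ha
  rw [h] at this
  exact mul_self_eq_one_iff.1 this

theorem star_eq_neg_of_inner_one {v : ℍ[ℝ]} (h : ⟪1, v⟫ = 0) : star v = -v := by
  rw [inner_def, one_mul, re_star] at h
  rw [star_eq_two_re_sub, h]; simp

theorem mul_eq_mul_star_of_inner {a v : ℍ[ℝ]} (hv : star v = -v) (h : ⟪a, v⟫ = 0) :
    a * v = v * star a := by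
  have h1 : (a * v).re = 0 := by
    rw [inner_def, hv, mul_neg, re_neg, neg_eq_zero] at h; exact h
  have h2 : star (a * v) = - (a * v) := by rw [star_eq_two_re_sub, h1]; simp
  rw [star_mul, hv, neg_mul, neg_inj] at h2
  exact h2.symm

theorem mul_self_of_star_eq_neg {v : ℍ[ℝ]} (h1 : ‖v‖ = 1) (hv : star v = -v) : v * v = -1 := by
  have := star_mul_self_eq_one h1
  rw [hv, neg_mul] at this
  rw [← this, neg_neg]

/-- A quaternion that commutes with the purely imaginary ones is real. -/
theorem star_eq_of_commute {z : ℍ[ℝ]} (h : ∀ v : ℍ[ℝ], star v = -v → v * v = -1 → z * v = v * z) :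
    star z = z := by
  obtain ⟨v, hv1, hv⟩ := exists_unit_orthogonal ![(1 : ℍ[ℝ]), z] (by rw [finrank_eq_four]; omega)
  have hv' : star v = -v := star_eq_neg_of_inner_one (hv 0)
  have h1 := mul_eq_mul_star_of_inner hv' (hv 1)
  rw [Matrix.cons_val_one, Matrix.cons_val_fin_one, h v hv' (mul_self_of_star_eq_neg hv1 hv')] at h1
  have hv0 : v ≠ 0 := by rintro rfl; simp at hv1
  exact (mul_left_cancel₀ hv0 h1).symm

/-- The first imaginary unit. -/
def unitI : ℍ[ℝ] := ⟨0, 1, 0, 0⟩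

/-- The second imaginary unit. -/
def unitJ : ℍ[ℝ] := ⟨0, 0, 1, 0⟩

/-- The third imaginary unit. -/
def unitK : ℍ[ℝ] := ⟨0, 0, 0, 1⟩

@[simp] theorem re_unitI : unitI.re = 0 := rfl
@[simp] theorem imI_unitI : unitI.imI = 1 := rfl
@[simp] theorem imJ_unitI : unitI.imJ = 0 := rfl
@[simp] theorem imK_unitI : unitI.imK = 0 := rfl
@[simp] theorem re_unitJ : unitJ.re = 0 := rfl
@[simp] theorem imI_unitJ : unitJ.imI = 0 := rfl
@[simp] theorem imJ_unitJ : unitJ.imJ = 1 := rfl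
@[simp] theorem imK_unitJ : unitJ.imK = 0 := rfl
@[simp] theorem re_unitK : unitK.re = 0 := rfl
@[simp] theorem imI_unitK : unitK.imI = 0 := rfl
@[simp] theorem imJ_unitK : unitK.imJ = 0 := rfl
@[simp] theorem imK_unitK : unitK.imK = 1 := rfl

theorem eq_units_smul (x : ℍ[ℝ]) :
    x = x.re • (1 : ℍ[ℝ]) + x.imI • unitI + x.imJ • unitJ + x.imK • unitK := by
  ext <;> simp

/-- An orthonormal triple of imaginary quaternions with the multiplication table of `i, j, k` is
conjugate to it. -/
theorem exists_conj_of_table {u v w : ℍ[ℝ]} (hu : u * u = -1) (hv : v * v = -1)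
    (huv : u * v = w) (hvu : v * u = -w) :
    ∃ q : ℍ[ℝ], ‖q‖ = 1 ∧ ∀ x : ℍ[ℝ],
      (x.re : ℍ[ℝ]) + x.imI • u + x.imJ • v + x.imK • w = q * x * star q := by
  set i := unitI with hi
  set j := unitJ with hj
  set k := unitK with hk
  have huw : u * w = -v := by rw [← huv, ← mul_assoc, hu]; simp
  have hvw : v * w = u := by
    have : w = -(v * u) := by rw [hvu, neg_neg]
    rw [this, mul_neg, ← mul_assoc, hv]; simp
  -- Averaging `g t g⁻¹` over the quaternion group, acting by `u, v, w` on the left and `i, j, k` on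
  -- the right, produces an intertwiner.
  let Q (t : ℍ[ℝ]) : ℍ[ℝ] := t - u * t * i - v * t * j - w * t * k
  have hii : i * i = -1 := by ext <;> simp [hi]
  have hjj : j * j = -1 := by ext <;> simp [hj]
  have hij : i * j = k := by ext <;> simp [hi, hj, hk]
  have hji : j * i = -k := by ext <;> simp [hi, hj, hk]
  have hki : k * i = j := by ext <;> simp [hi, hj, hk]
  have hkj : k * j = -i := by ext <;> simp [hi, hj, hk]
  have hQi (t) : u * Q t = Q t * i := by
    have e1 : u * (u * t * i) = -(t * i) := by simp only [← mul_assoc, hu]; simp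
    have e2 : u * (v * t * j) = w * t * j := by simp only [← mul_assoc, huv]
    have e3 : u * (w * t * k) = -(v * t * k) := by simp only [← mul_assoc, huw]; simp
    have e4 : u * t * i * i = -(u * t) := by rw [mul_assoc, hii]; simp
    have e5 : v * t * j * i = -(v * t * k) := by rw [mul_assoc, hji]; simp
    have e6 : w * t * k * i = w * t * j := by rw [mul_assoc, hki]
    simp only [Q, mul_sub, sub_mul, e1, e2, e3, e4, e5, e6]
    abel
  have hQj (t) : v * Q t = Q t * j := by
    have e1 : v * (u * t * i) = -(w * t * i) := by simp only [← mul_assoc, hvu]; simp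
    have e2 : v * (v * t * j) = -(t * j) := by simp only [← mul_assoc, hv]; simp
    have e3 : v * (w * t * k) = u * t * k := by simp only [← mul_assoc, hvw]
    have e4 : u * t * i * j = u * t * k := by rw [mul_assoc, hij]
    have e5 : v * t * j * j = -(v * t) := by rw [mul_assoc, hjj]; simp
    have e6 : w * t * k * j = -(w * t * i) := by rw [mul_assoc, hkj]; simp
    simp only [Q, mul_sub, sub_mul, e1, e2, e3, e4, e5, e6]
    abel
  -- This is the trace of the real linear map `Q`; being nonzero, it gives `Q ≠ 0`.
  have hsum : (Q 1 - Q i * i - Q j * j - Q k * k).re = 4 := by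
    simp [Q, hi, hj, hk]; ring
  obtain ⟨t, ht⟩ : ∃ t, Q t ≠ 0 := by
    by_contra! h
    rw [h, h, h, h] at hsum
    norm_num at hsum
  have hq1 : ‖(‖Q t‖⁻¹ : ℝ) • Q t‖ = 1 := norm_smul_inv_norm ht
  refine ⟨(‖Q t‖⁻¹ : ℝ) • Q t, hq1, fun x => ?_⟩
  set q := (‖Q t‖⁻¹ : ℝ) • Q t with hq
  have hqi : u * q = q * i := by rw [hq, mul_smul_comm, hQi, smul_mul_assoc]
  have hqj : v * q = q * j := by rw [hq, mul_smul_comm, hQj, smul_mul_assoc]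
  have hqk : w * q = q * k := by rw [← huv, mul_assoc, hqj, ← mul_assoc, hqi, mul_assoc, hij]
  have hx : x = x.re • 1 + x.imI • i + x.imJ • j + x.imK • k := eq_units_smul x
  have key : ((x.re : ℍ[ℝ]) + x.imI • u + x.imJ • v + x.imK • w) * q = q * x := by
    conv_rhs => rw [hx]
    simp only [add_mul, mul_add, smul_mul_assoc, mul_smul_comm, hqi, hqj, hqk, mul_one,
      coe_mul_eq_smul]
  rw [← key, mul_assoc, self_mul_star_eq_one hq1, mul_one]

/-- The linear isometries of `ℍ` are the maps `x ↦ p x q` and `x ↦ p x̄ q`. -/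
theorem exists_eq_mul_mul_of_norm_map (φ : ℍ[ℝ] ≃ₗ[ℝ] ℍ[ℝ]) (hφ : ∀ x, ‖φ x‖ = ‖x‖) :
    ∃ p q : ℍ[ℝ], ‖p‖ = 1 ∧ ‖q‖ = 1 ∧
      ((∀ x, φ x = p * x * q) ∨ ∀ x, φ x = p * star x * q) := by
  set p := φ 1 with hp
  have hp1 : ‖p‖ = 1 := by rw [hp, hφ, norm_one]
  let τ (x : ℍ[ℝ]) : ℍ[ℝ] := star p * φ x
  have hτadd (x y) : τ (x + y) = τ x + τ y := by simp [τ, mul_add]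
  have hτsmul (c : ℝ) (x) : τ (c • x) = c • τ x := by simp [τ]
  have hτ1 : τ 1 = 1 := star_mul_self_eq_one hp1
  have hφτ (x) : φ x = p * τ x := by
    simp only [τ, ← mul_assoc, self_mul_star_eq_one hp1, one_mul]
  have hτnorm (x) : ‖τ x‖ = ‖x‖ := by simp [τ, hφ, hp1]
  have hinner (x y) : ⟪τ x, τ y⟫ = ⟪x, y⟫ := by
    have h1 := norm_add_sq_real (τ x) (τ y)
    have h2 := norm_add_sq_real x y
    rw [← hτadd, hτnorm, hτnorm, hτnorm] at h1
    linarith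
  set i := unitI with hi
  set j := unitJ with hj
  set k := unitK with hk
  have him {x : ℍ[ℝ]} (hx : x.re = 0) : star (τ x) = -τ x := by
    apply star_eq_neg_of_inner_one
    rw [← hτ1, hinner, inner_def]
    simp [hx]
  have hnorm {x : ℍ[ℝ]} (hx : normSq x = 1) : ‖τ x‖ = 1 := by
    rw [hτnorm, ← sq_eq_sq₀ (norm_nonneg _) zero_le_one, sq, ← normSq_eq_norm_mul_self, hx]; simp
  have hui : star (τ i) = -τ i := him rfl
  have hvi : star (τ j) = -τ j := him rfl
  have hwi : star (τ k) = -τ k := him rfl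
  have hu1 := hnorm (x := i) (by simp [normSq_def', hi])
  have hv1 := hnorm (x := j) (by simp [normSq_def', hj])
  have hw1 := hnorm (x := k) (by simp [normSq_def', hk])
  have huu := mul_self_of_star_eq_neg hu1 hui
  have hvv := mul_self_of_star_eq_neg hv1 hvi
  have hww := mul_self_of_star_eq_neg hw1 hwi
  have huv : τ i * τ j = -(τ j * τ i) := by
    rw [mul_eq_mul_star_of_inner hvi (by rw [hinner, inner_def]; simp [hi, hj]), hui, mul_neg]
  have huw : τ i * τ k = -(τ k * τ i) := by
    rw [mul_eq_mul_star_of_inner hwi (by rw [hinner, inner_def]; simp [hi, hk]), hui, mul_neg]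
  have hvw : τ j * τ k = -(τ k * τ j) := by
    rw [mul_eq_mul_star_of_inner hwi (by rw [hinner, inner_def]; simp [hj, hk]), hvi, mul_neg]
  have hτ (x : ℍ[ℝ]) : τ x = (x.re : ℍ[ℝ]) + x.imI • τ i + x.imJ • τ j + x.imK • τ k := by
    have hx : x = x.re • 1 + x.imI • i + x.imJ • j + x.imK • k := eq_units_smul x
    conv_lhs => rw [hx]
    rw [hτadd, hτadd, hτadd, hτsmul, hτsmul, hτsmul, hτsmul, hτ1, ← coe_mul_eq_smul, mul_one]
  set u := τ i
  set v := τ j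
  set w := τ k
  have hwu : w * u = -(u * w) := by rw [huw, neg_neg]
  have hwv : w * v = -(v * w) := by rw [hvw, neg_neg]
  have hvu : v * u = -(u * v) := by rw [huv, neg_neg]
  -- The orientation of the image triple: `z` is central of norm one, so `±1`.
  set z := u * v * w with hz
  have hzu : z * u = u * z := by
    rw [hz]
    calc u * v * w * u = u * v * (w * u) := by noncomm_ring
      _ = -(u * (v * u) * w) := by rw [hwu]; noncomm_ring
      _ = u * (u * v * w) := by rw [hvu]; noncomm_ring
  have hzv : z * v = v * z := by
    rw [hz]
    calc u * v * w * v = u * v * (w * v) := by noncomm_ring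
      _ = -(u * v) * v * w := by rw [hwv]; noncomm_ring
      _ = v * (u * v * w) := by rw [← hvu]; noncomm_ring
  have hzw : z * w = w * z := by
    rw [hz]
    calc u * v * w * w = -(u * -(v * w) * w) := by noncomm_ring
      _ = -(u * w * v * w) := by rw [← hwv]; noncomm_ring
      _ = w * (u * v * w) := by rw [huw]; noncomm_ring
  have hsurj (y) : ∃ x, τ x = y := ⟨φ.symm (p * y), by
    simp only [τ, LinearEquiv.apply_symm_apply, ← mul_assoc, star_mul_self_eq_one hp1, one_mul]⟩
  have hzc : star z = z := by
    apply star_eq_of_commute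
    intro y _ _
    obtain ⟨x, rfl⟩ := hsurj y
    rw [hτ x]
    simp only [mul_add, add_mul, mul_smul_comm, smul_mul_assoc, hzu, hzv, hzw, coe_mul_eq_smul,
      mul_coe_eq_smul]
  have hz1 : ‖z‖ = 1 := by
    rw [hz, norm_mul, norm_mul, hu1, hv1, hw1, one_mul, one_mul]
  have huvw : u * v = -(z * w) := by rw [hz, mul_assoc (u * v), hww, mul_neg, mul_one, neg_neg]
  rcases eq_one_or_neg_one_of_star_eq hz1 hzc with h | h
  -- Here `uv = -w`, so the negated triple has the standard table, and the signs turn `x` into `x̄`.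
  · rw [h, one_mul] at huvw
    obtain ⟨q, hq, hqx⟩ := exists_conj_of_table (u := -u) (v := -v) (w := -w) (by simpa using huu)
      (by simpa using hvv) (by simpa using huvw) (by rw [neg_mul_neg, hvu, huvw])
    refine ⟨p * q, star q, by simp [hp1, hq], by simp [hq], Or.inr fun x => ?_⟩
    rw [hφτ, hτ, mul_assoc p, mul_assoc p, ← hqx]
    simp
  · rw [h, neg_one_mul, neg_neg] at huvw
    obtain ⟨q, hq, hqx⟩ := exists_conj_of_table huu hvv huvw (by rw [hvu, huvw])
    refine ⟨p * q, star q, by simp [hp1, hq], by simp [hq], Or.inl fun x => ?_⟩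
    rw [hφτ, hτ, mul_assoc p, mul_assoc p, ← hqx]

end Quaternion

/-! ### The identity in each of the four families -/

namespace Quaternion

open scoped RealInnerProductSpace

/-- Such a `v` is orthogonal to `1`, `a` and `b`, which is possible in dimension four. Words in `a`,
`b`, `v` can then be sorted and `v` cancelled. -/
theorem exists_unit_mul_eq_mul_star (a b : ℍ[ℝ]) :
    ∃ v : ℍ[ℝ], star v = -v ∧ v * v = -1 ∧ v ≠ 0 ∧ a * v = v * star a ∧ b * v = v * star b := by
  obtain ⟨v, hv1, hv⟩ := exists_unit_orthogonal ![(1 : ℍ[ℝ]), a, b] (by rw [finrank_eq_four]; omega)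
  have hv' : star v = -v := star_eq_neg_of_inner_one (hv 0)
  exact ⟨v, hv', mul_self_of_star_eq_neg hv1 hv', by rintro rfl; simp at hv1,
    mul_eq_mul_star_of_inner hv' (hv 1), mul_eq_mul_star_of_inner hv' (hv 2)⟩

theorem star_mul_eq_mul_of_mul_eq {a v : ℍ[ℝ]} (h : a * v = v * star a) :
    star a * v = v * a := by
  have h1 : a = ↑(2 * a.re) - star a := by rw [star_eq_two_re_sub]; abel
  have h2 : star a = ↑(2 * a.re) - a := star_eq_two_re_sub a
  calc star a * v = ↑(2 * a.re) * v - a * v := by rw [← sub_mul, ← h2]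
    _ = v * a := by rw [h, coe_commutes, ← mul_sub, ← h1]

theorem one_add_mul_self {v : ℍ[ℝ]} (hv : v * v = -1) :
    (1 + v) * (1 + v) = (2 : ℝ) • v := by
  rw [mul_add, add_mul, add_mul, hv]
  simp only [mul_one, one_mul]
  module

theorem one_sub_mul_self {v : ℍ[ℝ]} (hv : v * v = -1) :
    (1 - v) * (1 - v) = (-2 : ℝ) • v := by
  rw [mul_sub, sub_mul, sub_mul, hv]
  simp only [mul_one, one_mul]
  module

theorem star_eq_neg_of_mul_self {a : ℍ[ℝ]} (h : a * a = -1) : ‖a‖ = 1 ∧ star a = -a := by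
  have h1 : ‖a‖ = 1 := by
    have := congrArg norm h
    rw [norm_mul, norm_neg, norm_one, mul_self_eq_one_iff] at this
    exact this.resolve_right (by linarith [norm_nonneg a])
  refine ⟨h1, ?_⟩
  have ha : a ≠ 0 := by rintro rfl; simp at h1
  apply mul_right_cancel₀ ha
  rw [star_mul_self_eq_one h1, neg_mul, h, neg_neg]

/-- Putting `v = a` gives `(ab)² = 1`, so `b = ±a`. Then `av` and `va` would have equal squares for
all imaginary units `v`. -/
theorem not_forall_mul_mul_mul_eq {a b : ℍ[ℝ]} (ha : a * a = -1)
    (h : ∀ v : ℍ[ℝ], star v = -v → v * v = -1 → a * v * a * v = v * b * v * b) : False := by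
  obtain ⟨ha1, hstar⟩ := star_eq_neg_of_mul_self ha
  have h1 := h a hstar ha
  rw [ha, mul_assoc (-1 : ℍ[ℝ]), ha, neg_mul_neg, one_mul] at h1
  have h2 : (a * b) * (a * b) = 1 := by rw [h1]; noncomm_ring
  have h3 : ∀ v : ℍ[ℝ], star v = -v → v * v = -1 → a * v * a * v = v * a * v * a := by
    have hab : b = -(a * (a * b)) := by rw [← mul_assoc, ha]; simp
    intro v hv hvv
    rw [h v hv hvv]
    rcases mul_self_eq_one_iff.1 h2 with h4 | h4 <;> rw [h4] at hab <;> rw [hab] <;> simp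
  obtain ⟨v, hv, hvv, hv0, hav, -⟩ := exists_unit_mul_eq_mul_star a a
  rw [hstar, mul_neg] at hav
  have ha0 : a ≠ 0 := by rintro rfl; simp at ha
  have hav' (t) : a * (v * t) = -(v * (a * t)) := by rw [← mul_assoc, hav, neg_mul, mul_assoc]
  have haa (t) : a * (a * t) = -t := by rw [← mul_assoc, ha, neg_one_mul]
  have hvv' (t) : v * (v * t) = -t := by rw [← mul_assoc, hvv, neg_one_mul]
  -- A unit vector strictly between `a` and `v ⟂ a`, with rational coordinates; the two sides differ
  -- by `(48/25) v a`.
  have h5 := h3 ((3 / 5 : ℝ) • a + (4 / 5 : ℝ) • v) (by simp [hstar, hv]; abel) (by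
    simp only [mul_add, add_mul, smul_mul_assoc, mul_smul_comm, ha, hvv, hav]
    module)
  simp only [mul_add, add_mul, smul_mul_assoc, mul_smul_comm, mul_assoc, ha, hvv, hav, one_mul,
    hvv', mul_neg, neg_mul, mul_one, smul_add, smul_neg, neg_neg] at h5
  have h6 : v * a = 0 := by
    linear_combination (norm := module) (25 / 48 : ℝ) • h5
  exact mul_ne_zero hv0 ha0 h6

end Quaternion

namespace Quaternion

theorem eq_and_eq_of_add_of_sub {p q r s : ℍ[ℝ]} (h : p + q = r + s) (h' : p - q = r - s) :
    p = r ∧ q = s := by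
  constructor
  · linear_combination (norm := module) (1 / 2 : ℝ) • (h + h')
  · linear_combination (norm := module) (1 / 2 : ℝ) • (h - h')

theorem eq_one_or_neg_one_of_mul_mul {a b : ℍ[ℝ]} (ha : ‖a‖ = 1) (hb : ‖b‖ = 1)
    (h : ∀ x, a * (a * (a * x * x * b) * x * b) * (a * x * x * b) * b =
      a * (a * x * x * b) * (a * x * (a * x * x * b) * b) * b) :
    (a = 1 ∨ a = -1) ∧ (b = 1 ∨ b = -1) := by
  have ha0 : a ≠ 0 := by rintro rfl; simp at ha
  have hb0 : b ≠ 0 := by rintro rfl; simp at hb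
  have M (x : ℍ[ℝ]) :
      a * (x * x) * b * x * b * a * (x * x) = x * x * b * a * x * a * (x * x) * b := by
    have : (a * a) * (a * (x * x) * b * x * b * a * (x * x)) * (b * b) =
        (a * a) * (x * x * b * a * x * a * (x * x) * b) * (b * b) := by
      simpa only [mul_assoc] using h x
    exact mul_left_cancel₀ (mul_ne_zero ha0 ha0) (mul_right_cancel₀ (mul_ne_zero hb0 hb0) this)
  -- Since `(1 ± v)² = ±2v`, adding and subtracting the cases `x = 1 ± v` separates the
  -- contributions of `1` and `v` in the middle factor.
  have E {v : ℍ[ℝ]} (hvv : v * v = -1) : a * v * b * b * a * v = v * b * a * a * v * b ∧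
      a * v * b * v * b * a * v = v * b * a * v * a * v * b := by
    have h1 := M (1 + v)
    have h2 := M (1 - v)
    rw [one_add_mul_self hvv] at h1
    rw [one_sub_mul_self hvv] at h2
    simp only [mul_add, add_mul, mul_sub, sub_mul, mul_smul_comm, smul_mul_assoc, mul_one] at h1 h2
    apply eq_and_eq_of_add_of_sub
    · linear_combination (norm := module) (1 / 4 : ℝ) • h1
    · linear_combination (norm := module) (1 / 4 : ℝ) • h2
  have hsa := star_mul_self_eq_one ha
  have has := self_mul_star_eq_one ha
  have hsb := star_mul_self_eq_one hb
  have hbs := self_mul_star_eq_one hb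
  have cancel {p q : ℍ[ℝ]} (hpq : p * q = 1) (t : ℍ[ℝ]) : p * (q * t) = t := by
    rw [← mul_assoc, hpq, one_mul]
  obtain ⟨v, hv, hvv, hv0, hav, hbv⟩ := exists_unit_mul_eq_mul_star a b
  have hsav := star_mul_eq_mul_of_mul_eq hav
  have hsbv := star_mul_eq_mul_of_mul_eq hbv
  have move {p q : ℍ[ℝ]} (hp : p * v = v * q) (t : ℍ[ℝ]) : p * (v * t) = v * (q * t) := by
    rw [← mul_assoc, hp, mul_assoc]
  obtain ⟨h1, h2⟩ := E hvv
  -- After cancelling `v`, the relations give `ā² = b²` and then `a² = b²`, whence `a⁴ = 1`.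
  simp only [mul_assoc, hav, hbv, move hav, move hbv, move hsav, move hsbv,
    mul_right_inj' hv0] at h1 h2
  rw [cancel hbs, cancel has] at h2
  have h3 : a * a = b * b := by
    calc a * a = a * (star b * star b) * star a := by
          rw [← star_mul b b, ← h2, star_mul, star_star, mul_assoc, mul_assoc, has, mul_one]
      _ = star b * (star a * star a) * b := by simpa only [mul_assoc] using h1
      _ = b * b := by rw [h2, ← mul_assoc, hsb, one_mul]
  have h4 : (a * a) * (a * a) = 1 := by
    nth_rw 2 [h3]
    rw [← h2, mul_assoc, cancel has, has]
  rcases mul_self_eq_one_iff.1 h4 with h5 | h5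
  · exact ⟨mul_self_eq_one_iff.1 h5, mul_self_eq_one_iff.1 (h3 ▸ h5)⟩
  · refine (not_forall_mul_mul_mul_eq h5 (b := b) fun w hw hww => ?_).elim
    have h6 := (E hww).1
    rw [mul_assoc (a * w), ← h3, h5, mul_assoc (w * b), h5] at h6
    simpa using h6

theorem eq_one_or_neg_one_of_star_mul_star {a b : ℍ[ℝ]} (ha : ‖a‖ = 1) (hb : ‖b‖ = 1)
    (h : ∀ x,
      a * star (a * star (a * star x * star x * b) * star x * b) * star (a * star x * star x * b) * b
        = a * star (a * star x * star x * b) *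
          star (a * star x * star (a * star x * star x * b) * b) * b) :
    (a = 1 ∨ a = -1) ∧ (b = 1 ∨ b = -1) := by
  have ha0 : a ≠ 0 := by rintro rfl; simp at ha
  have hb0 : b ≠ 0 := by rintro rfl; simp at hb
  have hsa0 : star a ≠ 0 := star_ne_zero.2 ha0
  have hsb0 : star b ≠ 0 := star_ne_zero.2 hb0
  have hsa := star_mul_self_eq_one ha
  have has := self_mul_star_eq_one ha
  have hsb := star_mul_self_eq_one hb
  have hbs := self_mul_star_eq_one hb
  have cancel {p q : ℍ[ℝ]} (hpq : p * q = 1) (t : ℍ[ℝ]) : p * (q * t) = t := by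
    rw [← mul_assoc, hpq, one_mul]
  have M (x : ℍ[ℝ]) :
      x * a * (star x * star x) * b * star a * star b * (x * x) =
        x * x * star a * star b * a * (star x * star x) * b * x := by
    have : (a * star b) * (x * a * (star x * star x) * b * star a * star b * (x * x))
          * (star a * b) =
        (a * star b) * (x * x * star a * star b * a * (star x * star x) * b * x)
          * (star a * b) := by
      have := h x
      simp only [star_mul, star_star, mul_assoc] at this ⊢
      exact this
    exact mul_left_cancel₀ (mul_ne_zero ha0 hsb0) (mul_right_cancel₀ (mul_ne_zero hsa0 hb0) this)
  have E {v : ℍ[ℝ]} (hv : star v = -v) (hvv : v * v = -1) :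
      a * v * b * star a * star b * v = v * star a * star b * a * v * b ∧
      v * a * v * b * star a * star b * v = v * star a * star b * a * v * b * v := by
    have h1 := M (1 + v)
    have h2 := M (1 - v)
    rw [star_add, hv, star_one, ← sub_eq_add_neg, one_add_mul_self hvv, one_sub_mul_self hvv] at h1
    rw [star_sub, hv, star_one, sub_neg_eq_add, one_add_mul_self hvv, one_sub_mul_self hvv] at h2
    simp only [mul_add, add_mul, mul_sub, sub_mul, mul_smul_comm, smul_mul_assoc, mul_one,
      one_mul] at h1 h2
    apply eq_and_eq_of_add_of_sub
    · linear_combination (norm := module) (-1 / 4 : ℝ) • h1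
    · linear_combination (norm := module) (-1 / 4 : ℝ) • h2
  obtain ⟨v, hv, hvv, hv0, hav, hbv⟩ := exists_unit_mul_eq_mul_star a b
  have hsav := star_mul_eq_mul_of_mul_eq hav
  have hsbv := star_mul_eq_mul_of_mul_eq hbv
  have move {p q : ℍ[ℝ]} (hp : p * v = v * q) (t : ℍ[ℝ]) : p * (v * t) = v * (q * t) := by
    rw [← mul_assoc, hp, mul_assoc]
  obtain ⟨h1, h2⟩ := E hv hvv
  simp only [mul_assoc, hav, hbv, hsbv, move hav, move hbv, move hsav, move hsbv,
    mul_right_inj' hv0, mul_right_inj' ha0] at h1 h2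
  have h3 : star b * a = b * star a := mul_right_cancel₀ hb0 (by simpa only [mul_assoc] using h1)
  have h4 : star a * b = a * star b := by simpa using congrArg star h3
  have h5 : a * b = star a * star b := by
    rw [h1, ← h4] at h2
    exact mul_right_cancel₀ (mul_ne_zero hsa0 hb0) (by simpa only [mul_assoc] using h2)
  have h6 : (a * a) * (a * a) = 1 := by
    have h7 : a * (a * b) = star b := by rw [h5, cancel has]
    have h8 : a * (a * star b) = b := by rw [← h4, cancel has]
    apply mul_right_cancel₀ hb0
    rw [mul_assoc, mul_assoc, mul_assoc a a b, h7, h8, one_mul]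
  rcases mul_self_eq_one_iff.1 h6 with h7 | h7
  · have ha' := mul_self_eq_one_iff.1 h7
    refine ⟨ha', eq_one_or_neg_one_of_star_eq hb ?_⟩
    rcases ha' with rfl | rfl <;> simpa using h5.symm
  · have hstar := (star_eq_neg_of_mul_self h7).2
    have hbstar : star b = -b := by
      rw [hstar, neg_mul, ← mul_neg] at h5
      exact (neg_eq_iff_eq_neg.2 (mul_left_cancel₀ ha0 h5)).symm
    -- With `a`, `b` imaginary, the identity at imaginary units says that `abab` commutes with them.
    -- Either sign of `abab = ±1` reduces to `not_forall_mul_mul_mul_eq`.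
    have hz : star (a * b * a * b) = a * b * a * b := by
      apply star_eq_of_commute
      intro w hw hww
      have := M w
      rw [hw, neg_mul_neg, hww, hstar, hbstar] at this
      simp only [mul_assoc, mul_neg, neg_mul, one_mul, mul_one, neg_neg] at this ⊢
      exact this.symm
    have hz1 : ‖a * b * a * b‖ = 1 := by simp [ha, hb]
    refine (not_forall_mul_mul_mul_eq h7 (b := b) fun w hw hww => ?_).elim
    have hbb : b * b = -1 := by
      have := hsb
      rw [hbstar, neg_mul] at this
      rw [← this, neg_neg]
    have h8 := (E hw hww).1
    rw [hstar, hbstar] at h8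
    rcases eq_one_or_neg_one_of_star_eq hz1 hz with h9 | h9
    · have e1 : b * a * b = -a := by
        apply mul_left_cancel₀ ha0
        rw [mul_neg, h7, neg_neg, ← h9]; simp only [mul_assoc]
      have e2 : a * b * a = -b := by
        apply mul_right_cancel₀ hb0
        rw [neg_mul, hbb, neg_neg, h9]
      have h10 : a * w * (b * a * b) * w = w * (a * b * a) * w * b := by
        simpa only [mul_assoc, mul_neg, neg_mul, neg_neg] using h8
      rw [e1, e2] at h10
      simpa using h10
    · have e1 : b * a * b = a := by
        apply mul_left_cancel₀ ha0
        rw [h7, ← h9]; simp only [mul_assoc]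
      have e2 : a * b * a = b := by
        apply mul_right_cancel₀ hb0
        rw [hbb, h9]
      have h10 : a * w * (b * a * b) * w = w * (a * b * a) * w * b := by
        simpa only [mul_assoc, mul_neg, neg_mul, neg_neg] using h8
      rwa [e1, e2] at h10

theorem eq_one_or_neg_one_of_star_mul {a b : ℍ[ℝ]} (ha : ‖a‖ = 1) (hb : ‖b‖ = 1)
    (h : ∀ x,
      star (star (star x * a * x * b) * a * x * b) * a * (star x * a * x * b) * b =
        star (star x * a * x * b) * a * (star x * a * (star x * a * x * b) * b) * b) :
    a = 1 ∨ a = -1 := by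
  have ha0 : a ≠ 0 := by rintro rfl; simp at ha
  have hb0 : b ≠ 0 := by rintro rfl; simp at hb
  have hsa0 : star a ≠ 0 := star_ne_zero.2 ha0
  have hsb0 : star b ≠ 0 := star_ne_zero.2 hb0
  have hsa := star_mul_self_eq_one ha
  have has := self_mul_star_eq_one ha
  have M (x : ℍ[ℝ]) : star x * a * x * b * a * star x * a * x =
      x * a * star x * a * star x * a * x * b := by
    rcases eq_or_ne x 0 with rfl | hx
    · simp
    have : (star b * star x * star a) *
          (star x * a * x * b * a * star x * a * x) * (b * b) =
        (star b * star x * star a) * (x * a * star x * a * star x * a * x * b) * (b * b) := by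
      have := h x
      simp only [star_mul, star_star, mul_assoc] at this ⊢
      exact this
    exact mul_left_cancel₀ (mul_ne_zero (mul_ne_zero hsb0 (star_ne_zero.2 hx)) hsa0)
      (mul_right_cancel₀ (mul_ne_zero hb0 hb0) this)
  -- On imaginary elements the identity says that `b` commutes with `(av)²`.
  have F (v : ℍ[ℝ]) (hv : star v = -v) : b * (a * v * a * v) = a * v * a * v * b := by
    rcases eq_or_ne v 0 with rfl | hv0
    · simp
    have h1 := M v
    simp only [hv, neg_mul, mul_neg, neg_neg] at h1
    apply mul_left_cancel₀ (mul_ne_zero (mul_ne_zero hv0 ha0) hv0)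
    simpa only [mul_assoc] using h1
  apply eq_one_or_neg_one_of_star_eq ha
  by_contra hne
  obtain ⟨v, hv, hvv, hv0, hav, hbv⟩ := exists_unit_mul_eq_mul_star a b
  have hsav := star_mul_eq_mul_of_mul_eq hav
  have move {p q : ℍ[ℝ]} (hp : p * v = v * q) (t : ℍ[ℝ]) : p * (v * t) = v * (q * t) := by
    rw [← mul_assoc, hp, mul_assoc]
  have cancel {p q : ℍ[ℝ]} (hpq : p * q = 1) (t : ℍ[ℝ]) : p * (q * t) = t := by
    rw [← mul_assoc, hpq, one_mul]
  have hbreal : star b = b := by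
    -- Polarising `F` at `n ± va` isolates a cross term equal to `-‖n‖² v`. So `b` commutes with
    -- `v`, while also `bv = v b̄`; hence `b` is real.
    set n := a - star a with hn
    have hnstar : star n = -n := by rw [hn, star_sub, star_star, neg_sub]
    have hw : star (v * a) = -(v * a) := by rw [star_mul, hv, mul_neg, hsav]
    have h1 := F (n + v * a) (by rw [star_add, hnstar, hw]; abel)
    have h2 := F (n - v * a) (by rw [star_sub, hnstar, hw]; abel)
    have hC : b * (a * n * a * (v * a) + a * (v * a) * a * n) =
        (a * n * a * (v * a) + a * (v * a) * a * n) * b := by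
      simp only [mul_add, add_mul, mul_sub, sub_mul] at h1 h2 ⊢
      linear_combination (norm := module) (1 / 2 : ℝ) • (h1 - h2)
    have hnv : n * v = -(v * n) := by
      rw [hn, sub_mul, hav, hsav, mul_sub]; abel
    have hava : a * (v * a) = v := by rw [← mul_assoc, hav, mul_assoc, hsa, mul_one]
    have hCv : a * n * a * (v * a) + a * (v * a) * a * n = (-normSq n) • v := by
      calc a * n * a * (v * a) + a * (v * a) * a * n = a * (n * v) + v * a * n := by
            rw [mul_assoc (a * n), hava, mul_assoc a n]
        _ = -(a * v * n) + v * a * n := by rw [hnv, mul_neg, mul_assoc a v]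
        _ = -(v * (star n * n)) := by rw [hnstar, hav, hn]; noncomm_ring
        _ = (-normSq n) • v := by rw [star_mul_self, mul_coe_eq_smul, neg_smul]
    rw [hCv, mul_smul_comm, smul_mul_assoc, hbv] at hC
    have hn0 : -normSq n ≠ 0 := neg_ne_zero.2 (normSq_ne_zero.2 (sub_ne_zero.2 (Ne.symm hne)))
    exact mul_left_cancel₀ hv0 (smul_right_injective _ hn0 hC)
  have hb1 : b = 1 ∨ b = -1 := eq_one_or_neg_one_of_star_eq hb hbreal
  have h1 : ∀ x : ℍ[ℝ], x ≠ 0 → star x * a * x = x * a * star x := by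
    intro x hx
    have h2 : (star x * a * x) * (a * star x * a * x) =
        (x * a * star x) * (a * star x * a * x) := by
      have := M x
      rcases hb1 with rfl | rfl <;> simpa [mul_assoc] using this
    exact mul_right_cancel₀ (by simp [ha0, hx]) h2
  have h2 := h1 (1 + v) (fun h0 => by
    have : v = -1 := by rw [eq_neg_iff_add_eq_zero, add_comm, h0]
    have hre := congrArg QuaternionAlgebra.re hvv
    rw [this] at hre
    norm_num at hre)
  rw [star_add, hv, star_one] at h2
  simp only [mul_add, add_mul, mul_neg, neg_mul, mul_one, one_mul] at h2
  have h3 : a * v = v * a := by linear_combination (norm := module) (1 / 2 : ℝ) • h2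
  rw [hav] at h3
  exact hne (mul_left_cancel₀ hv0 h3)

/-- Conjugation is an anti-isomorphism of `ℍ*(a, b)` onto `*ℍ(b̄, ā)`, and the identity is invariant
under reversing products. -/
theorem eq_one_or_neg_one_of_mul_star {a b : ℍ[ℝ]} (ha : ‖a‖ = 1) (hb : ‖b‖ = 1)
    (h : ∀ x,
      a * (a * (a * x * b * star x) * b * star x) * b * star (a * x * b * star x) =
        a * (a * x * b * star x) * b * star (a * x * b * star (a * x * b * star x))) :
    b = 1 ∨ b = -1 := by
  have := eq_one_or_neg_one_of_star_mul (a := star b) (b := star a) (by simpa) (by simpa)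
    fun x => by
      have := congrArg star (h (star x))
      simp only [star_mul, star_star, mul_assoc] at this ⊢
      exact this.symm
  exact this.imp (fun h => by rw [← star_star b, h, star_one])
    (fun h => by rw [← star_star b, h, star_neg, star_one])

end Quaternion

/-! ### Reduction to isotopes of the quaternions -/

section Isotope

variable {V : Type*} [NormedAddCommGroup V] [NormedSpace ℝ V]
  {m : V →ₗ[ℝ] V →ₗ[ℝ] V}

theorem norm_flip_of_norm_mul (hm : ∀ x y, ‖m x y‖ = ‖x‖ * ‖y‖) (x y : V) :
    ‖m.flip x y‖ = ‖x‖ * ‖y‖ := by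
  rw [LinearMap.flip_apply, hm, mul_comm]

variable [FiniteDimensional ℝ V]

/-- Multiplication by a norm-one element is a linear isometry. -/
noncomputable def mulIsometry (hm : ∀ x y, ‖m x y‖ = ‖x‖ * ‖y‖) {a : V} (ha : ‖a‖ = 1) :
    V ≃ₗᵢ[ℝ] V :=
  LinearIsometry.toLinearIsometryEquiv
    { toLinearMap := m a, norm_map' := fun x => by rw [hm, ha, one_mul] } rfl

theorem mulIsometry_apply (hm : ∀ x y, ‖m x y‖ = ‖x‖ * ‖y‖) {a : V} (ha : ‖a‖ = 1) (x : V) :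
    mulIsometry hm ha x = m a x := by
  simp [mulIsometry]

theorem exists_isometry_of_norm_mul (hm : ∀ x y, ‖m x y‖ = ‖x‖ * ‖y‖) (x y : V)
    (hxy : ‖x‖ = ‖y‖) : ∃ g : V ≃ₗᵢ[ℝ] V, g x = y := by
  rcases eq_or_ne x 0 with rfl | hx
  · refine ⟨LinearIsometryEquiv.refl ℝ V, ?_⟩
    rw [norm_zero] at hxy
    rw [map_zero, norm_eq_zero.1 hxy.symm]
  have hx' : ‖x‖ ≠ 0 := norm_ne_zero_iff.2 hx
  have hinj : Function.Injective (m.flip x) := by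
    rw [← LinearMap.ker_eq_bot, LinearMap.ker_eq_bot']
    intro z hz
    have := norm_flip_of_norm_mul hm x z
    rw [hz, norm_zero, eq_comm, mul_eq_zero] at this
    exact norm_eq_zero.1 (this.resolve_left hx')
  obtain ⟨a, ha⟩ := LinearMap.injective_iff_surjective.1 hinj y
  have ha1 : ‖a‖ = 1 := by
    have := norm_flip_of_norm_mul hm x a
    rw [ha, ← hxy] at this
    exact mul_left_cancel₀ hx' (by rw [← this, mul_one])
  exact ⟨mulIsometry hm ha1, by rw [mulIsometry_apply]; exact ha⟩

/-- Every four-dimensional absolute-valued real algebra is, up to isomorphism, the quaternion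
algebra with a product `φ(x) ψ(y)` where `φ` and `ψ` are linear isometries. -/
theorem exists_isotope (hV : Module.finrank ℝ V = 4) (hm : ∀ x y, ‖m x y‖ = ‖x‖ * ‖y‖) :
    ∃ (f : V ≃ₗ[ℝ] ℍ[ℝ]) (φ ψ : ℍ[ℝ] ≃ₗ[ℝ] ℍ[ℝ]), (∀ x, ‖φ x‖ = ‖x‖) ∧ (∀ x, ‖ψ x‖ = ‖x‖) ∧
      ∀ x y, f (m x y) = φ (f x) * ψ (f y) := by
  let _ : InnerProductSpace ℝ V := InnerProductSpace.ofNorm (𝕜 := ℝ)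
    (parallelogram_of_transitive (exists_isometry_of_norm_mul hm))
  have : Nontrivial V := Module.nontrivial_of_finrank_pos (R := ℝ) (by omega)
  obtain ⟨c, hc⟩ := exists_norm_eq V zero_le_one
  let L := mulIsometry hm hc
  let R := mulIsometry (norm_flip_of_norm_mul hm) hc
  have hL (x) : L x = m c x := mulIsometry_apply hm hc x
  have hR (x) : R x = m x c := mulIsometry_apply (norm_flip_of_norm_mul hm) hc x
  -- Kaplansky's trick: undoing multiplication by `c` on each side makes `c²` a two-sided unit.
  let m' : V →ₗ[ℝ] V →ₗ[ℝ] V := m.compl₁₂ (R.symm.toLinearEquiv : V →ₗ[ℝ] V)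
    (L.symm.toLinearEquiv : V →ₗ[ℝ] V)
  have hm'a (x y) : m' x y = m (R.symm x) (L.symm y) := rfl
  have hm' (x y) : ‖m' x y‖ = ‖x‖ * ‖y‖ := by
    rw [hm'a, hm, LinearIsometryEquiv.norm_map, LinearIsometryEquiv.norm_map]
  have hRc : R.symm (m c c) = c := by rw [← hR, R.symm_apply_apply]
  have hLc : L.symm (m c c) = c := by rw [← hL, L.symm_apply_apply]
  obtain ⟨F, hF, hFm⟩ := exists_quaternion_equiv hV hm' (e := m c c)
    (by rw [hm, hc, one_mul]) (fun y => by rw [hm'a, hRc, ← hL, L.apply_symm_apply])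
    (fun y => by rw [hm'a, hLc, ← hR, R.apply_symm_apply])
  have hF' (x) : ‖F.symm x‖ = ‖x‖ := by rw [← hF, F.apply_symm_apply]
  refine ⟨F.symm, F.trans (R.toLinearEquiv.trans F.symm), F.trans (L.toLinearEquiv.trans F.symm),
    fun x => ?_, fun x => ?_, fun x y => ?_⟩
  · simp [hF', hF]
  · simp [hF', hF]
  · apply F.injective
    rw [hFm, F.apply_symm_apply, hm'a]
    simp

end Isotope

/-! ### Normal forms with two parameters -/

namespace Quaternion

/-- Left multiplication by a norm-one quaternion. -/
noncomputable def mulLeftEquiv {u : ℍ[ℝ]} (hu : ‖u‖ = 1) : ℍ[ℝ] ≃ₗ[ℝ] ℍ[ℝ] :=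
  LinearEquiv.ofLinearMap (LinearMap.mulLeft ℝ u) (LinearMap.mulLeft ℝ (star u))
    (by ext1 x; simp [← mul_assoc, self_mul_star_eq_one hu])
    (by ext1 x; simp [← mul_assoc, star_mul_self_eq_one hu])

/-- Right multiplication by a norm-one quaternion. -/
noncomputable def mulRightEquiv {u : ℍ[ℝ]} (hu : ‖u‖ = 1) : ℍ[ℝ] ≃ₗ[ℝ] ℍ[ℝ] :=
  LinearEquiv.ofLinearMap (LinearMap.mulRight ℝ u) (LinearMap.mulRight ℝ (star u))
    (by ext1 x; simp [mul_assoc, star_mul_self_eq_one hu])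
    (by ext1 x; simp [mul_assoc, self_mul_star_eq_one hu])

@[simp]
theorem mulLeftEquiv_apply {u : ℍ[ℝ]} (hu : ‖u‖ = 1) (x : ℍ[ℝ]) : mulLeftEquiv hu x = u * x := rfl

@[simp]
theorem mulRightEquiv_apply {u : ℍ[ℝ]} (hu : ‖u‖ = 1) (x : ℍ[ℝ]) :
    mulRightEquiv hu x = x * u := rfl

end Quaternion

namespace AbsValuedAlg

open Quaternion

/-- The four families of four-dimensional absolute-valued real algebras. -/
theorem exists_normal_form (A : AbsValuedAlg.{u}) (hA : A.FourDimensional) :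
    ∃ (f : A.carrier ≃ₗ[ℝ] ℍ[ℝ]) (a b : ℍ[ℝ]), ‖a‖ = 1 ∧ ‖b‖ = 1 ∧
      ((∀ x y, f (A.mul x y) = a * f x * f y * b) ∨
       (∀ x y, f (A.mul x y) = star (f x) * a * f y * b) ∨
       (∀ x y, f (A.mul x y) = a * f x * b * star (f y)) ∨
       (∀ x y, f (A.mul x y) = a * star (f x) * star (f y) * b)) := by
  have hfin : Module.finrank ℝ A.carrier = 4 := hA
  have : FiniteDimensional ℝ A.carrier := Module.finite_of_finrank_pos (by omega)
  obtain ⟨f, φ, ψ, hφ, hψ, hf⟩ := exists_isotope hfin A.norm_mul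
  obtain ⟨p, q, hp, hq, hpq⟩ := exists_eq_mul_mul_of_norm_map φ hφ
  obtain ⟨r, s, hr, hs, hrs⟩ := exists_eq_mul_mul_of_norm_map ψ hψ
  have cancel {p : ℍ[ℝ]} (hp : ‖p‖ = 1) (t : ℍ[ℝ]) : p * (star p * t) = t := by
    rw [← mul_assoc, self_mul_star_eq_one hp, one_mul]
  have cancel' {p : ℍ[ℝ]} (hp : ‖p‖ = 1) (t : ℍ[ℝ]) : star p * (p * t) = t := by
    rw [← mul_assoc, star_mul_self_eq_one hp, one_mul]
  -- Each case composes `f` with the one-sided multiplication that leaves only two constants in the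
  -- product.
  have hc : ‖q * r‖ = 1 := by simp [hq, hr]
  rcases hpq with h1 | h1 <;> rcases hrs with h2 | h2
  · refine ⟨f.trans (mulRightEquiv hc), p, star (q * r) * s * (q * r), hp, by simp [*],
      Or.inl fun x y => ?_⟩
    simp only [LinearEquiv.trans_apply, mulRightEquiv_apply, hf, h1, h2, mul_assoc, star_mul,
      cancel hq, cancel hr]
  · refine ⟨f.trans (mulLeftEquiv (u := star s) (by simpa)), star s * p * s, q * r, by simp [*],
      hc, Or.inr (Or.inr (Or.inl fun x y => ?_))⟩
    simp only [LinearEquiv.trans_apply, mulLeftEquiv_apply, hf, h1, h2, mul_assoc, star_mul,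
      star_star, cancel hs]
  · refine ⟨f.trans (mulRightEquiv (u := star p) (by simpa)), q * r, p * s * star p, hc,
      by simp [*], Or.inr (Or.inl fun x y => ?_)⟩
    simp only [LinearEquiv.trans_apply, mulRightEquiv_apply, hf, h1, h2, mul_assoc, star_mul,
      star_star, cancel' hp]
  · refine ⟨f.trans (mulLeftEquiv (u := star (q * r)) (by rw [norm_star, hc])), star (q * r) * p,
      star (q * r) * s, by rw [_root_.norm_mul, norm_star, hc, hp, one_mul],
      by rw [_root_.norm_mul, norm_star, hc, hs, one_mul], Or.inr (Or.inr (Or.inr fun x y => ?_))⟩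
    simp only [LinearEquiv.trans_apply, mulLeftEquiv_apply, hf, h1, h2, mul_assoc, star_mul,
      star_star, cancel hq, cancel hr]

end AbsValuedAlg

/-! ### Conjugacy to `e^{iα}`, and verification of the identity -/

namespace Quaternion

theorem exists_conj_eq_re_add {b : ℍ[ℝ]} (hb : ‖b‖ = 1) :
    ∃ u : ℍ[ℝ], ‖u‖ = 1 ∧ u * b * star u = (b.re : ℍ[ℝ]) + √(1 - b.re ^ 2) • unitI := by
  set t := √(1 - b.re ^ 2) with ht
  set n := b - b.re with hn
  have hnre : n.re = 0 := by simp [hn]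
  have hnI : n.imI = b.imI := by simp [hn]
  have hnJ : n.imJ = b.imJ := by simp [hn]
  have hnK : n.imK = b.imK := by simp [hn]
  have hsq : b.re ^ 2 + b.imI ^ 2 + b.imJ ^ 2 + b.imK ^ 2 = 1 := by
    rw [← normSq_def', normSq_eq_norm_mul_self, hb, one_mul]
  have htsq : t ^ 2 = b.imI ^ 2 + b.imJ ^ 2 + b.imK ^ 2 := by
    rw [ht, Real.sq_sqrt (by nlinarith)]; linarith
  obtain ⟨u, hu0, hu⟩ : ∃ u : ℍ[ℝ], u ≠ 0 ∧ u * n = t • (unitI * u) := by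
    -- As `n² = -t²`, the element `t - i n` intertwines `n` with `t i`. It vanishes only if `n = -t
    -- i`, and then `j` serves.
    by_cases h0 : (t : ℍ[ℝ]) - unitI * n = 0
    · have hn' : n = -(t • unitI) := by
        have h1 : unitI * n = t := (sub_eq_zero.1 h0).symm
        have h2 : unitI * (unitI * n) = -n := by ext <;> simp
        rw [h1, mul_coe_eq_smul] at h2
        rw [h2, neg_neg]
      refine ⟨unitJ, fun h => by simpa using congrArg QuaternionAlgebra.imJ h, ?_⟩
      rw [hn']
      ext <;> simp
    · refine ⟨_, h0, ?_⟩
      ext <;> simp [hnre, hnI, hnJ, hnK] <;> first | ring1 | linear_combination -htsq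
  have hb' : b = b.re + n := by rw [hn]; abel
  have key : u * b = ((b.re : ℍ[ℝ]) + t • unitI) * u := by
    conv_lhs => rw [hb']
    rw [mul_add, add_mul, hu, smul_mul_assoc, coe_commutes]
  have h1 : ‖(‖u‖⁻¹ : ℝ) • u‖ = 1 := norm_smul_inv_norm hu0
  refine ⟨(‖u‖⁻¹ : ℝ) • u, h1, ?_⟩
  rw [smul_mul_assoc, key, ← mul_smul_comm, mul_assoc, self_mul_star_eq_one h1, mul_one]

end Quaternion

namespace AbsValuedAlg

open Quaternion

theorem coe_expI (α : ℝ) : (expI α : ℍ[ℝ]) = (Real.cos α : ℍ[ℝ]) + Real.sin α • unitI := by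
  ext <;> simp [expI, Complex.exp_ofReal_mul_I_re, Complex.exp_ofReal_mul_I_im]

/-- Up to sign, every norm-one quaternion is conjugate to some `e^{iα}` with `α ∈ [0, π)`. -/
theorem exists_conj_expI {b : ℍ[ℝ]} (hb : ‖b‖ = 1) :
    ∃ u : ℍ[ℝ], ‖u‖ = 1 ∧ ∃ α ∈ Set.Ico (0 : ℝ) Real.pi,
      u * b * star u = expI α ∨ u * b * star u = -expI α := by
  obtain ⟨u, hu, h⟩ := exists_conj_eq_re_add hb
  have hre : b.re ^ 2 ≤ 1 := by
    have : b.re ^ 2 + b.imI ^ 2 + b.imJ ^ 2 + b.imK ^ 2 = 1 := by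
      rw [← normSq_def', normSq_eq_norm_mul_self, hb, one_mul]
    nlinarith
  obtain ⟨hl, hr⟩ := abs_le.1 ((sq_le_one_iff_abs_le_one _).1 hre)
  refine ⟨u, hu, ?_⟩
  rcases hl.eq_or_lt with h1 | h1
  -- Here `b = -1`; the excluded angle `π` is replaced by `-e^{i0}`.
  · refine ⟨0, ⟨le_rfl, Real.pi_pos⟩, Or.inr ?_⟩
    rw [h, ← h1, coe_expI]
    simp
  · refine ⟨Real.arccos b.re, ⟨Real.arccos_nonneg _, ?_⟩, Or.inl ?_⟩
    · refine lt_of_le_of_ne (Real.arccos_le_pi _) fun h2 => ?_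
      exact absurd (Real.arccos_eq_pi.1 h2) (not_le.2 h1)
    · rw [h, coe_expI, Real.cos_arccos hl hr, Real.sin_arccos]

theorem map_assoc {A : AbsValuedAlg.{u}} {B : AbsValuedAlg.{v}} (f : A.carrier ≃ₗ[ℝ] B.carrier)
    (hf : ∀ x y, f (A.mul x y) = B.mul (f x) (f y)) (x y z : A.carrier) :
    f (A.assoc x y z) = B.assoc (f x) (f y) (f z) := by
  simp only [assoc, map_sub, hf]

theorem Satisfies212.of_iso {A : AbsValuedAlg.{u}} {B : AbsValuedAlg.{v}} (h : A.Iso B)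
    (hB : B.Satisfies212) : A.Satisfies212 := by
  obtain ⟨f, hf⟩ := h
  intro x
  apply f.injective
  rw [map_assoc f hf, hf, hB, map_zero]

theorem satisfies212_quat : quat.Satisfies212 := fun x : ℍ[ℝ] => by
  change x * x * x * (x * x) - x * x * (x * (x * x)) = 0
  simp only [mul_assoc, sub_self]

theorem satisfies212_starQuatStar : starQuatStar.Satisfies212 := fun x : ℍ[ℝ] => by
  change star (star (star x * star x) * star x) * star (star x * star x) -
    star (star x * star x) * star (star x * star (star x * star x)) = 0
  have h : x * star x = star x * x := by rw [self_mul_star, star_mul_self]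
  have h' (t : ℍ[ℝ]) : x * (star x * t) = star x * (x * t) := by rw [← mul_assoc, h, mul_assoc]
  simp only [star_mul, star_star, mul_assoc, h, h', sub_self]

/-- Squares are real multiples of `b`, so only `(b, x, b) = 0` matters; both of its terms are `b̄ x̄
b³`. -/
theorem satisfies212_starQuat (b : Metric.sphere (0 : ℍ[ℝ]) 1) :
    (starQuat 1 b).Satisfies212 := fun x : ℍ[ℝ] => by
  change star (star (star x * 1 * x * b) * 1 * x * b) * 1 * (star x * 1 * x * b) * b -
    star (star x * 1 * x * b) * 1 * (star x * 1 * (star x * 1 * x * b) * b) * b = 0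
  simp only [mul_one, star_mul_self, coe_mul_eq_smul, Quaternion.star_smul, star_mul, star_star,
    smul_mul_assoc, mul_smul_comm, mul_assoc, sub_self]

theorem satisfies212_quatStar (a : Metric.sphere (0 : ℍ[ℝ]) 1) :
    (quatStar a 1).Satisfies212 := fun x : ℍ[ℝ] => by
  change a * (a * (a * x * 1 * star x) * 1 * star x) * 1 * star (a * x * 1 * star x) -
    a * (a * x * 1 * star x) * 1 * star (a * x * 1 * star (a * x * 1 * star x)) = 0
  simp only [mul_one, mul_assoc, self_mul_star, mul_coe_eq_smul, Quaternion.star_smul, star_mul, star_star,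
    smul_mul_assoc, mul_smul_comm, mul_assoc, sub_self]

end AbsValuedAlg

/-! ### The classification and the count of isomorphism classes -/

namespace AbsValuedAlg

open Quaternion

/-- Conjugation by a norm-one quaternion. -/
noncomputable def conjEquiv {u : ℍ[ℝ]} (hu : ‖u‖ = 1) : ℍ[ℝ] ≃ₗ[ℝ] ℍ[ℝ] :=
  (mulLeftEquiv hu).trans (mulRightEquiv (u := star u) (by simpa))

theorem conjEquiv_apply {u : ℍ[ℝ]} (hu : ‖u‖ = 1) (x : ℍ[ℝ]) :
    conjEquiv hu x = u * x * star u := rfl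

theorem exists_iso_starQuat {A : AbsValuedAlg.{u}} (f : A.carrier ≃ₗ[ℝ] ℍ[ℝ]) {b : ℍ[ℝ]}
    (hb : ‖b‖ = 1) (hf : ∀ x y, f (A.mul x y) = star (f x) * f y * b) :
    ∃ α ∈ Set.Ico (0 : ℝ) Real.pi, A.Iso (starQuat 1 (expI α)) := by
  obtain ⟨u, hu, α, hα, h⟩ := exists_conj_expI hb
  have cancel (t : ℍ[ℝ]) : star u * (u * t) = t := by
    rw [← mul_assoc, star_mul_self_eq_one hu, one_mul]
  have key (x y) : conjEquiv hu (f (A.mul x y)) =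
      star (conjEquiv hu (f x)) * conjEquiv hu (f y) * (u * b * star u) := by
    simp only [conjEquiv_apply, hf, star_mul, star_star, mul_assoc, cancel]
  refine ⟨α, hα, ?_⟩
  rcases h with h | h
  · refine ⟨f.trans (conjEquiv hu), fun x y => ?_⟩
    change conjEquiv hu (f (A.mul x y)) =
      star (conjEquiv hu (f x)) * 1 * conjEquiv hu (f y) * expI α
    rw [key, h, mul_one]
  · refine ⟨(f.trans (conjEquiv hu)).trans (LinearEquiv.neg ℝ), fun x y => ?_⟩
    change -conjEquiv hu (f (A.mul x y)) =
      star (-conjEquiv hu (f x)) * 1 * -conjEquiv hu (f y) * expI α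
    rw [key, h, mul_one, star_neg, neg_mul_neg, mul_neg, neg_neg]

theorem exists_iso_quatStar {A : AbsValuedAlg.{u}} (f : A.carrier ≃ₗ[ℝ] ℍ[ℝ]) {a : ℍ[ℝ]}
    (ha : ‖a‖ = 1) (hf : ∀ x y, f (A.mul x y) = a * f x * star (f y)) :
    ∃ α ∈ Set.Ico (0 : ℝ) Real.pi, A.Iso (quatStar (expI α) 1) := by
  obtain ⟨u, hu, α, hα, h⟩ := exists_conj_expI ha
  have cancel (t : ℍ[ℝ]) : star u * (u * t) = t := by
    rw [← mul_assoc, star_mul_self_eq_one hu, one_mul]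
  have key (x y) : conjEquiv hu (f (A.mul x y)) =
      (u * a * star u) * conjEquiv hu (f x) * star (conjEquiv hu (f y)) := by
    simp only [conjEquiv_apply, hf, star_mul, star_star, mul_assoc, cancel]
  refine ⟨α, hα, ?_⟩
  rcases h with h | h
  · refine ⟨f.trans (conjEquiv hu), fun x y => ?_⟩
    change conjEquiv hu (f (A.mul x y)) =
      expI α * conjEquiv hu (f x) * 1 * star (conjEquiv hu (f y))
    rw [key, h, mul_one]
  · refine ⟨(f.trans (conjEquiv hu)).trans (LinearEquiv.neg ℝ), fun x y => ?_⟩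
    change -conjEquiv hu (f (A.mul x y)) =
      expI α * -conjEquiv hu (f x) * 1 * star (-conjEquiv hu (f y))
    rw [key, h, mul_one, star_neg]
    simp only [neg_mul, mul_neg, neg_neg]

theorem classification (A : AbsValuedAlg.{u}) (hA : A.FourDimensional) (h : A.Satisfies212) :
    A.Iso quat ∨ A.Iso starQuatStar ∨ ∃ α ∈ Set.Ico (0 : ℝ) Real.pi,
      A.Iso (starQuat 1 (expI α)) ∨ A.Iso (quatStar (expI α) 1) := by
  obtain ⟨f, a, b, ha, hb, hf⟩ := A.exists_normal_form hA
  have hx (x : ℍ[ℝ]) := sub_eq_zero.1 (h (f.symm x))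
  rcases hf with hf | hf | hf | hf
  · have hid (x : ℍ[ℝ]) := congrArg f (hx x)
    simp only [hf, f.apply_symm_apply] at hid
    obtain ⟨ha' | ha', hb' | hb'⟩ := eq_one_or_neg_one_of_mul_mul ha hb hid <;>
      subst ha' <;> subst hb' <;> left
    · exact ⟨f, fun x y => (hf x y).trans (by simp; rfl)⟩
    · refine ⟨f.trans (LinearEquiv.neg ℝ), fun x y => ?_⟩
      change -f (A.mul x y) = -f x * -f y
      rw [hf]; simp
    · refine ⟨f.trans (LinearEquiv.neg ℝ), fun x y => ?_⟩
      change -f (A.mul x y) = -f x * -f y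
      rw [hf]; simp
    · exact ⟨f, fun x y => (hf x y).trans (by simp; rfl)⟩
  · have hid (x : ℍ[ℝ]) := congrArg f (hx x)
    simp only [hf, f.apply_symm_apply] at hid
    obtain ⟨α, hα, hiso⟩ := exists_iso_starQuat f (b := a * b) (by simp [ha, hb]) fun x y => by
      rcases eq_one_or_neg_one_of_star_mul ha hb hid with rfl | rfl <;> simp [hf]
    exact Or.inr (Or.inr ⟨α, hα, Or.inl hiso⟩)
  · have hid (x : ℍ[ℝ]) := congrArg f (hx x)
    simp only [hf, f.apply_symm_apply] at hid
    obtain ⟨α, hα, hiso⟩ := exists_iso_quatStar f (a := a * b) (by simp [ha, hb]) fun x y => by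
      rcases eq_one_or_neg_one_of_mul_star ha hb hid with rfl | rfl <;> simp [hf]
    exact Or.inr (Or.inr ⟨α, hα, Or.inr hiso⟩)
  · have hid (x : ℍ[ℝ]) := congrArg f (hx x)
    simp only [hf, f.apply_symm_apply] at hid
    obtain ⟨ha' | ha', hb' | hb'⟩ := eq_one_or_neg_one_of_star_mul_star ha hb hid <;>
      subst ha' <;> subst hb' <;> right <;> left
    · exact ⟨f, fun x y => (hf x y).trans (by simp; rfl)⟩
    · refine ⟨f.trans (LinearEquiv.neg ℝ), fun x y => ?_⟩
      change -f (A.mul x y) = star (-f x) * star (-f y)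
      rw [hf]; simp
    · refine ⟨f.trans (LinearEquiv.neg ℝ), fun x y => ?_⟩
      change -f (A.mul x y) = star (-f x) * star (-f y)
      rw [hf]; simp
    · exact ⟨f, fun x y => (hf x y).trans (by simp; rfl)⟩

/-- The same algebra on a carrier in a higher universe. -/
noncomputable def lift (A : AbsValuedAlg.{v}) : AbsValuedAlg.{max v u} where
  carrier := ULift.{u} A.carrier
  mul :=
    let e : ULift.{u} A.carrier ≃ₗ[ℝ] A.carrier := ULift.moduleEquiv
    (A.mul.compl₁₂ e.toLinearMap e.toLinearMap).compr₂ e.symm.toLinearMap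
  norm_mul x y := A.norm_mul x.down y.down

theorem lift_iso (A : AbsValuedAlg.{v}) : (lift.{u} A).Iso A :=
  ⟨ULift.moduleEquiv, fun _ _ => rfl⟩

theorem finrank_starQuat (a b : Metric.sphere (0 : ℍ[ℝ]) 1) : (starQuat a b).FourDimensional :=
  Quaternion.finrank_eq_four

theorem FourDimensional.of_iso {A : AbsValuedAlg.{u}} {B : AbsValuedAlg.{v}} (h : A.Iso B)
    (hB : B.FourDimensional) : A.FourDimensional := by
  obtain ⟨f, -⟩ := h
  exact f.finrank_eq.trans hB

theorem mul_self_eq_two_re_smul_sub_one {b : ℍ[ℝ]} (hb : ‖b‖ = 1) :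
    b * b = (2 * b.re) • b - 1 := by
  have h := star_mul_self_eq_one hb
  rw [star_eq_two_re_sub, sub_mul, coe_mul_eq_smul] at h
  rw [← h, sub_sub_cancel]

/-- An isomorphism matches the unique nonzero idempotents `b` and `c`, hence conjugates `y ↦ b̄ y b`
to `y ↦ c̄ y c`. These rotate by twice the angles of `b` and `c`. -/
theorem re_sq_eq_of_iso {b c : Metric.sphere (0 : ℍ[ℝ]) 1} (hc : (c : ℍ[ℝ]) * c ≠ 1)
    (h : (starQuat 1 b).Iso (starQuat 1 c)) : (b : ℍ[ℝ]).re ^ 2 = (c : ℍ[ℝ]).re ^ 2 := by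
  obtain ⟨b, hb⟩ := b
  obtain ⟨c, hc1⟩ := c
  rw [mem_sphere_zero_iff_norm] at hb hc1
  dsimp only at hc ⊢
  obtain ⟨f, hf⟩ : ∃ f : ℍ[ℝ] ≃ₗ[ℝ] ℍ[ℝ], ∀ x y, f (star x * y * b) = star (f x) * f y * c := by
    obtain ⟨F, hf⟩ := h
    let f : ℍ[ℝ] ≃ₗ[ℝ] ℍ[ℝ] := F
    refine ⟨f, fun x y => ?_⟩
    have h1 : f (star x * 1 * y * b) = star (f x) * 1 * f y * c := hf x y
    simpa only [mul_one] using h1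
  have hb0 : b ≠ 0 := by rintro rfl; simp at hb
  have hc0 : c ≠ 0 := by rintro rfl; simp at hc1
  have hfb : f b = c := by
    have h1 := hf b b
    rw [star_mul_self_eq_one hb, one_mul, star_mul_self, coe_mul_eq_smul] at h1
    have h2 := congrArg normSq h1
    rw [normSq_smul, normSq_eq_norm_mul_self c, hc1, mul_one, mul_one] at h2
    have h3 : normSq (f b) ≠ 0 := normSq_ne_zero.2 (by simpa using hb0)
    have h4 : normSq (f b) = 1 := by
      apply mul_left_cancel₀ h3
      rw [mul_one, ← sq, ← h2]
    rw [h1, h4, one_smul]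
  have hT (y) : f (star b * y * b) = star c * f y * c := by rw [hf, hfb]
  have hbb := mul_self_eq_two_re_smul_sub_one hb
  have hcc := mul_self_eq_two_re_smul_sub_one hc1
  set p := 2 * b.re with hp
  set q := 2 * c.re with hq
  have hbt (t) : b * (b * t) = p • (b * t) - t := by
    rw [← mul_assoc, hbb, sub_mul, smul_mul_assoc, one_mul]
  have hbs : star b = p • 1 - b := by
    rw [star_eq_two_re_sub, ← hp, ← coe_mul_eq_smul, mul_one]
  -- With `T y = b̄ y b`, this is `(T - 1)(T² - (p² - 2)T + 1) = 0`, where `p² - 2` is twice the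
  -- cosine of the rotation angle.
  have hTb (y : ℍ[ℝ]) : star b * (star b * (star b * y * b) * b) * b
      - (p ^ 2 - 1) • (star b * (star b * y * b) * b) + (p ^ 2 - 1) • (star b * y * b) - y = 0 := by
    simp only [hbs, mul_sub, sub_mul, mul_assoc, smul_mul_assoc, mul_smul_comm, one_mul, mul_one,
      hbb, hbt, smul_sub]
    module
  obtain ⟨w, hw, hww, hw0, hcw, -⟩ := exists_unit_mul_eq_mul_star c c
  have hscw := star_mul_eq_mul_of_mul_eq hcw
  have h1 := congrArg f (hTb (f.symm w))
  simp only [map_sub, map_add, map_smul, hT, f.apply_symm_apply, map_zero] at h1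
  have move (t : ℍ[ℝ]) : star c * (w * t) = w * (c * t) := by rw [← mul_assoc, hscw, mul_assoc]
  -- Since `c̄ w c = w c²`, the transported cubic relation becomes a polynomial equation for `c²`.
  have h2 : w * ((c * c - 1) * ((c * c) * (c * c) - (p ^ 2 - 2) • (c * c) + 1)) = 0 := by
    rw [← h1]
    simp only [mul_assoc, hscw, move, mul_sub, sub_mul, mul_add, mul_smul_comm, mul_one, one_mul]
    module
  have h3 : (c * c) * (c * c) - (p ^ 2 - 2) • (c * c) + 1 = 0 :=
    (mul_eq_zero.1 ((mul_eq_zero.1 h2).resolve_left hw0)).resolve_left (sub_ne_zero.2 hc)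
  have h4 : (q ^ 2 - p ^ 2) • (c * c) = 0 := by
    rw [← h3]
    simp only [hcc, mul_sub, sub_mul, mul_smul_comm, smul_mul_assoc, mul_one, one_mul]
    module
  have h5 := (smul_eq_zero.1 h4).resolve_right (mul_ne_zero hc0 hc0)
  rw [hp, hq] at h5
  linarith

theorem expI_injective_of_iso {α β : ℝ} (hα : α ∈ Set.Ioc 0 (Real.pi / 2))
    (hβ : β ∈ Set.Ioc 0 (Real.pi / 2)) (h : (starQuat 1 (expI α)).Iso (starQuat 1 (expI β))) :
    α = β := by
  have hpi := Real.pi_pos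
  have hre (γ : ℝ) : (expI γ : ℍ[ℝ]).re = Real.cos γ := by rw [coe_expI]; simp
  have hsin : 0 < Real.sin β := Real.sin_pos_of_pos_of_lt_pi hβ.1 (by linarith [hβ.2])
  have hne : (expI β : ℍ[ℝ]) * expI β ≠ 1 := fun h1 => by
    have h2 := congrArg QuaternionAlgebra.re h1
    rw [coe_expI] at h2
    simp at h2
    nlinarith [Real.sin_sq_add_cos_sq β]
  have h1 := re_sq_eq_of_iso hne h
  rw [hre, hre] at h1
  have h2 : Real.cos α = Real.cos β := (sq_eq_sq₀
    (Real.cos_nonneg_of_mem_Icc ⟨by linarith [hα.1], hα.2⟩)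
    (Real.cos_nonneg_of_mem_Icc ⟨by linarith [hβ.1], hβ.2⟩)).1 h1
  exact Real.injOn_cos ⟨hα.1.le, by linarith [hα.2]⟩ ⟨hβ.1.le, by linarith [hβ.2]⟩ h2

theorem infinite_isoClasses :
    Set.Infinite {c : Quotient isoSetoid.{u} |
      ∃ A : AbsValuedAlg.{u}, A.FourDimensional ∧ A.Satisfies212 ∧
        Quotient.mk isoSetoid A = c} := by
  -- The shift by 2 keeps the angles in `(0, π/2]`, where `cos²` is injective and `e^{2iα} ≠ 1`.
  let angle (n : ℕ) : ℝ := Real.pi / (n + 2)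
  have hangle (n : ℕ) : angle n ∈ Set.Ioc 0 (Real.pi / 2) := by
    refine ⟨by positivity, ?_⟩
    exact div_le_div_of_nonneg_left Real.pi_pos.le two_pos (by linarith [n.cast_nonneg (α := ℝ)])
  let B (n : ℕ) : AbsValuedAlg.{u} := lift.{u} (starQuat 1 (expI (angle n)))
  refine Set.infinite_of_injective_forall_mem (f := fun n => Quotient.mk isoSetoid (B n))
    (fun m n hmn => ?_) fun n => ⟨B n, .of_iso (lift_iso _) (finrank_starQuat _ _),
      .of_iso (lift_iso _) (satisfies212_starQuat _), rfl⟩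
  have h1 : (B m).Iso (B n) := Quotient.exact hmn
  have h2 := expI_injective_of_iso (hangle m) (hangle n)
    ((lift_iso _).symm.trans (h1.trans (lift_iso _)))
  have h3 : (m : ℝ) + 2 = n + 2 := by
    have := Real.pi_ne_zero
    have hm : (m : ℝ) + 2 ≠ 0 := by positivity
    have hn : (n : ℝ) + 2 ≠ 0 := by positivity
    simp only [angle] at h2
    field_simp at h2
    linarith
  exact_mod_cast add_right_cancel h3

end AbsValuedAlg

theorem mainTheorem4 :
    (∀ A : AbsValuedAlg.{u}, A.FourDimensional →
      (A.Satisfies212 ↔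
        A.Iso AbsValuedAlg.quat ∨ A.Iso AbsValuedAlg.starQuatStar ∨
        ∃ α ∈ Set.Ico (0 : ℝ) Real.pi,
          A.Iso (AbsValuedAlg.starQuat 1 (AbsValuedAlg.expI α)) ∨
          A.Iso (AbsValuedAlg.quatStar (AbsValuedAlg.expI α) 1))) ∧
    Set.Infinite {c : Quotient AbsValuedAlg.isoSetoid.{u} |
      ∃ A : AbsValuedAlg.{u}, A.FourDimensional ∧ A.Satisfies212 ∧
        Quotient.mk AbsValuedAlg.isoSetoid A = c} := by
  refine ⟨fun A hA => ⟨A.classification hA, ?_⟩, AbsValuedAlg.infinite_isoClasses⟩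
  rintro (h | h | ⟨α, -, h | h⟩)
  · exact .of_iso h AbsValuedAlg.satisfies212_quat
  · exact .of_iso h AbsValuedAlg.satisfies212_starQuatStar
  · exact .of_iso h (AbsValuedAlg.satisfies212_starQuat _)
  · exact .of_iso h (AbsValuedAlg.satisfies212_quatStar _)
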